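/- All graphs are finite, undirected and simple. A graph is embedded in a closed surface $S$ if its vertices are distinct points of $S$ and its edges are simple paths in $S$ that intersect only at endpoints; the embedding is cellular if every connected component of the complement (face) is an open disc, so that $S$ is obtained by gluing to the graph one polygon for each face, along the closed walk bounding that face. A graph is called planar (respectively toroidal) if it is, or is a subgraph of, a finite simple graph cellularly embedded in the sphere $S^2$ (respectively in the torus $S^1\times S^1$). The girth of a graph is the length of its shortest cycle, and $\infty$ if there is no cycle. For an integer $q\ge 2$, the (zero-temperature) Wang–Swendsen–Kotecký (WSK) algorithm on a graph $G$ is the following Markov chain on the set of proper $q$-colourings of $G$. At a colouring $\sigma$, choose uniformly at random two distinct colours $a,b\in\{1,\dots,q\}$, and let $G_{ab}$ be the subgraph of $G$ induced by the vertices $x$ with $\sigma_x\in\{a,b\}$; then, independently for each connected component of $G_{ab}$, with probability $1/2$ interchange the colours $a$ and $b$ on it, and otherwise leave it unchanged. The algorithm is ergodic if there is an $N$ such that for every $n\ge N$ and all proper $q$-colourings $\sigma,\tau$ of $G$ the chain started at $\sigma$ is at $\tau$ after $n$ steps with positive probability (equivalently, any two proper $q$-colourings are joined by a finite sequence of Kempe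 moves, i.e. interchanges of two colours $a,b$ on one component of $G_{ab}$). Corollary 3.3. Let $q$ be an integer. (a) For every planar graph, WSK is ergodic for $q\ge 6$. (b) For every triangle-free planar graph, WSK is ergodic for $q\ge 4$. (c) For every planar graph of girth $\ge 6$, WSK is ergodic for $q\ge 3$. (d) For every toroidal graph, WSK is ergodic for $q\ge 7$. (e) For every triangle-free toroidal graph, WSK is ergodic for $q\ge 5$. (f) For every toroidal graph of girth $\ge 5$, WSK is ergodic for $q\ge 4$. (g) For every toroidal graph of girth $\ge 7$, WSK is ergodic for $q\ge 3$. -/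

import Mathlib

universe u

/-! ## Graphs drawn on a surface -/

/-- An embedding of the graph `G` in the space `S`: vertices are distinct points, edges are simple
paths joining their end vertices, and these paths meet vertices and each other only at their ends.
The path of an edge is given once for each of its two orientations (darts). -/
structure GraphEmbedding {V : Type u} (G : SimpleGraph V) (S : Type) [TopologicalSpace S] where
  vertex : V → S
  vertex_injective : Function.Injective vertex
  arc : G.Dart → C(unitInterval, S)
  arc_injective : ∀ d, Function.Injective (arc d)
  arc_zero : ∀ d, arc d 0 = vertex d.fst
  arc_symm : ∀ d t, arc d.symm t = arc d (unitInterval.symm t)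
  arc_vertex : ∀ d t v, arc d t = vertex v → t = 0 ∨ t = 1
  arc_arc : ∀ d e s t, d.edge ≠ e.edge → arc d s = arc e t → (s = 0 ∨ s = 1) ∧ (t = 0 ∨ t = 1)

/-- The subset of the surface occupied by the embedded graph. -/
def GraphEmbedding.support {V : Type u} {G : SimpleGraph V} {S : Type} [TopologicalSpace S]
    (φ : GraphEmbedding G S) : Set S :=
  Set.range φ.vertex ∪ ⋃ d, Set.range (φ.arc d)

/-- A cellular (2-cell) embedding of `G` in the oriented surface `S`. `S` is glued from finitely
many polygons, one for each face, the polygon of the face `i` being the closed unit disc with its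
boundary circle cut into `len i` equal sides. The sides of all the polygons are labelled by the
oriented edges of `G`, each of them used once, and the polygons are glued to the graph by sending
each side to the edge that labels it; the open discs are sent homeomorphically (a continuous
bijection suffices, as the closed disc is compact) to the faces, which are the connected
components of the complement of the graph. The polygon without sides, whose whole boundary is sent
to a vertex, is needed for the one-vertex graph on the sphere. -/
structure CellularEmbedding {V : Type u} (G : SimpleGraph V) (S : Type) [TopologicalSpace S]
    extends GraphEmbedding G S where
  Face : Type
  face_finite : Finite Face
  len : Face → ℕ
  side : (Σ i : Face, Fin (len i)) ≃ G.Dart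
  cell : Face → ℂ → S
  cell_continuousOn : ∀ i, ContinuousOn (cell i) (Metric.closedBall 0 1)
  cell_injOn : ∀ i, Set.InjOn (cell i) (Metric.ball 0 1)
  cell_disjoint : ∀ i j, i ≠ j →
    Disjoint (cell i '' Metric.ball 0 1) (cell j '' Metric.ball 0 1)
  cell_cover : ⋃ i, cell i '' Metric.ball 0 1 = (toGraphEmbedding.support)ᶜ
  cell_side : ∀ (i : Face) (k : Fin (len i)) (t : unitInterval),
    cell i (Complex.exp (2 * Real.pi * Complex.I * ((k : ℕ) + (t : ℝ)) / len i)) =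
      arc (side ⟨i, k⟩) t
  cell_boundary_of_len_eq_zero : ∀ i, len i = 0 → ∃ v, ∀ z ∈ Metric.sphere (0 : ℂ) 1,
    cell i z = vertex v

/-- `G` can be drawn on `S`: it is cellularly embedded in `S`, or it is (up to isomorphism) a
subgraph of a finite graph that is. -/
def DrawableOn {V : Type u} (G : SimpleGraph V) (S : Type) [TopologicalSpace S] : Prop :=
  ∃ (W : Type u) (_ : Finite W) (H : SimpleGraph W),
    Nonempty (CellularEmbedding H S) ∧ G.IsContained H

/-- Graphs cellularly embedded in `S` can be drawn on `S`. -/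
theorem CellularEmbedding.drawableOn {V : Type u} [Finite V] {G : SimpleGraph V} {S : Type}
    [TopologicalSpace S] (φ : CellularEmbedding G S) : DrawableOn G S :=
  ⟨V, inferInstance, G, ⟨φ⟩, SimpleGraph.IsContained.refl G⟩

/-- Planar graphs: graphs on the 2-sphere. -/
def IsPlanarGraph {V : Type u} (G : SimpleGraph V) : Prop :=
  DrawableOn G (Metric.sphere (0 : EuclideanSpace ℝ (Fin 3)) 1)

/-- Toroidal graphs: graphs on the torus. -/
def IsToroidalGraph {V : Type u} (G : SimpleGraph V) : Prop :=
  DrawableOn G (Circle × Circle)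

/-! ## The Wang–Swendsen–Kotecký chain at zero temperature -/

/-- The subgraph `G_{ab}` induced by the vertices that `σ` colours `a` or `b`. -/
abbrev twoColourGraph {V : Type u} (G : SimpleGraph V) {q : ℕ} (σ : G.Coloring (Fin q))
    (a b : Fin q) : SimpleGraph {x : V | σ x = a ∨ σ x = b} :=
  G.induce {x : V | σ x = a ∨ σ x = b}

open Classical in
/-- Interchange the colours `a` and `b` on those components of `G_{ab}` that `s` selects. -/
noncomputable def flipColour {V : Type u} (G : SimpleGraph V) {q : ℕ} (σ : G.Coloring (Fin q))
    (a b : Fin q) (s : (twoColourGraph G σ a b).ConnectedComponent → Bool) (x : V) : Fin q :=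
  if h : σ x = a ∨ σ x = b then
    if s ((twoColourGraph G σ a b).connectedComponentMk ⟨x, h⟩) then Equiv.swap a b (σ x) else σ x
  else σ x

theorem flipColour_mem_iff {V : Type u} (G : SimpleGraph V) {q : ℕ} (σ : G.Coloring (Fin q))
    (a b : Fin q) (s : (twoColourGraph G σ a b).ConnectedComponent → Bool) (x : V) :
    (flipColour G σ a b s x = a ∨ flipColour G σ a b s x = b) ↔ (σ x = a ∨ σ x = b) := by
  unfold flipColour
  split_ifs with h hs
  · rcases h with h | h <;> simp [h]
  · rfl
  · rfl

theorem flipColour_ne {V : Type u} (G : SimpleGraph V) {q : ℕ} (σ : G.Coloring (Fin q))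
    (a b : Fin q) (s : (twoColourGraph G σ a b).ConnectedComponent → Bool) {x y : V}
    (hxy : G.Adj x y) : flipColour G σ a b s x ≠ flipColour G σ a b s y := by
  have hne : σ x ≠ σ y := σ.valid hxy
  have ix := flipColour_mem_iff G σ a b s x
  have iy := flipColour_mem_iff G σ a b s y
  by_cases hx : σ x = a ∨ σ x = b <;> by_cases hy : σ y = a ∨ σ y = b
  · have hc : (twoColourGraph G σ a b).connectedComponentMk ⟨x, hx⟩ =
        (twoColourGraph G σ a b).connectedComponentMk ⟨y, hy⟩ :=
      SimpleGraph.ConnectedComponent.connectedComponentMk_eq_of_adj (by simpa using hxy)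
    simp only [flipColour, hx, hy, hc, dif_pos]
    split_ifs
    · exact fun h => hne ((Equiv.swap a b).injective h)
    · exact hne
  · intro h
    rw [h] at ix
    exact hy (iy.mp (ix.mpr hx))
  · intro h
    rw [h] at ix
    exact hx (ix.mp (iy.mpr hy))
  · simpa [flipColour, hx, hy] using hne

/-- `flipColour` as a proper colouring. -/
noncomputable def flipColouring {V : Type u} (G : SimpleGraph V) {q : ℕ} (σ : G.Coloring (Fin q))
    (a b : Fin q) (s : (twoColourGraph G σ a b).ConnectedComponent → Bool) :
    G.Coloring (Fin q) :=
  SimpleGraph.Coloring.mk (flipColour G σ a b s) (flipColour_ne G σ a b s)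

open Classical in
/-- One step of the chain from `σ`: choose uniformly an (ordered) pair of distinct colours `a, b`,
flip one fair coin for each connected component of `G_{ab}`, independently (that is, choose `s`
uniformly), and interchange `a` and `b` on the components whose coin says so. -/
noncomputable def wskStep {V : Type u} [Finite V] (G : SimpleGraph V) {q : ℕ} (hq : 2 ≤ q)
    (σ : G.Coloring (Fin q)) : PMF (G.Coloring (Fin q)) :=
  haveI : Nonempty {p : Fin q × Fin q // p.1 ≠ p.2} :=
    ⟨⟨(⟨0, by omega⟩, ⟨1, by omega⟩), by simp⟩⟩
  (PMF.uniformOfFintype {p : Fin q × Fin q // p.1 ≠ p.2}).bind fun p =>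
    haveI := Fintype.ofFinite (twoColourGraph G σ p.1.1 p.1.2).ConnectedComponent
    (PMF.uniformOfFintype ((twoColourGraph G σ p.1.1 p.1.2).ConnectedComponent → Bool)).map
      (flipColouring G σ p.1.1 p.1.2)

/-- The law of the chain started at `σ` after `n` steps. -/
noncomputable def wskLaw {V : Type u} [Finite V] (G : SimpleGraph V) {q : ℕ} (hq : 2 ≤ q) :
    ℕ → G.Coloring (Fin q) → PMF (G.Coloring (Fin q))
  | 0, σ => PMF.pure σ
  | n + 1, σ => (wskLaw G hq n σ).bind (wskStep G hq)

/-- The WSK algorithm for `q`-colourings of `G` is ergodic: after any sufficiently large number of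
steps every proper `q`-colouring is reached from every other with positive probability. -/
def WSKErgodic {V : Type u} [Finite V] (G : SimpleGraph V) (q : ℕ) : Prop :=
  ∃ hq : 2 ≤ q, ∃ N : ℕ, ∀ n ≥ N, ∀ σ τ : G.Coloring (Fin q), 0 < wskLaw G hq n σ τ

/-! ## Kempe equivalence on degenerate graphs -/

section Kempe

variable {V : Type u} (G : SimpleGraph V) {q : ℕ}

/-! The proof has a combinatorial and a topological half.

Combinatorial half: if every nonempty vertex set `A` contains a vertex with fewer than `q`
neighbours in `A`, all proper `q`-colourings are Kempe equivalent (`kempe_connected`): remove such a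
vertex, join the restricted colourings by induction, and lift each move back, recolouring the
removed vertex when it is in the way (`KempeMove.lift`). Since the chain may also stay put and there
are finitely many colourings, one number of steps serves all pairs (`wskErgodic_of_degenerate`).

Topological half: such a vertex exists by Euler's inequality `m + 2 ≤ n + h + c` together with `g *
c ≤ 2 * m`, where `h` is `0` on the sphere and `2` on the torus. If all `n` degrees in `A` were at
least `q`, then `q * n ≤ 2 * m`, which is impossible for the listed `q` and `g`.

Euler's inequality is obtained by linear algebra over `ℚ`, so that induced subgraphs need be neither
connected nor cellularly embedded. An integral cocycle of the ambient cell complex is the winding of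
a map from the surface to `ℝ/ℤ` (`exists_circleMap`), and it is a coboundary if that map lifts to
`ℝ`. Hence the first cohomology has rank at most the bound `h` of `CircleRankLE`, which is found for
the sphere and the torus by lifting to the plane. Dually, cycles modulo face boundaries have rank at
most `h`. Intersecting face boundaries with the cycles of the subgraph gives the inequality
(`card_add_one_le`); its faces are classes of old faces merged across deleted edges, and each
nonempty boundary contains a cycle (`le_card_boundaryEdges`). -/

/-- `σ` is a proper colouring of the subgraph of `G` induced by `A`. -/
def ProperOn (A : Finset V) (σ : V → Fin q) : Prop :=
  ∀ x ∈ A, ∀ y ∈ A, G.Adj x y → σ x ≠ σ y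

/-- `τ` arises from `σ` by interchanging two colours `a`, `b` on a union `U` of components of
the subgraph of `G[A]` induced by the colours `a` and `b`. -/
def KempeMove (A : Finset V) (σ τ : V → Fin q) : Prop :=
  ∃ a b : Fin q, a ≠ b ∧ ∃ U : Set V, (∀ x ∈ U, x ∈ A ∧ (σ x = a ∨ σ x = b)) ∧
    (∀ x ∈ U, ∀ y ∈ A, G.Adj x y → (σ y = a ∨ σ y = b) → y ∈ U) ∧
    (∀ x ∈ U, τ x = Equiv.swap a b (σ x)) ∧ ∀ x ∉ U, τ x = σ x

variable {G}

theorem KempeMove.properOn {A : Finset V} {σ τ : V → Fin q} (h : KempeMove G A σ τ)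
    (hσ : ProperOn G A σ) : ProperOn G A τ := by
  obtain ⟨a, b, hab, U, hU, hcl, hin, hout⟩ := h
  have key : ∀ x ∈ A, ∀ y ∈ A, G.Adj x y → x ∈ U → y ∉ U → τ x ≠ τ y := by
    intro x hx y hy hxy hxU hyU h
    rw [hin x hxU, hout y hyU] at h
    apply hyU
    apply hcl x hxU y hy hxy
    rcases (hU x hxU).2 with h' | h' <;> rw [h'] at h <;> simp at h <;> simp [← h]
  intro x hx y hy hxy
  by_cases hxU : x ∈ U <;> by_cases hyU : y ∈ U
  · rw [hin x hxU, hin y hyU]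
    exact fun h => hσ x hx y hy hxy ((Equiv.swap a b).injective h)
  · exact key x hx y hy hxy hxU hyU
  · exact (key y hy x hx hxy.symm hyU hxU).symm
  · rw [hout x hxU, hout y hyU]
    exact hσ x hx y hy hxy

/-- No neighbour of `v` has the old or the new colour, so `v` alone is a two-coloured component. -/
theorem kempeMove_update [DecidableEq V] {A : Finset V} {σ : V → Fin q} {v : V} (hv : v ∈ A)
    (hσ : ProperOn G A σ) {c : Fin q} (hc : c ≠ σ v) (hN : ∀ y ∈ A, G.Adj v y → σ y ≠ c) :
    KempeMove G A σ (Function.update σ v c) := by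
  refine ⟨σ v, c, hc.symm, {v}, ?_, ?_, ?_, ?_⟩
  · rintro x rfl
    exact ⟨hv, Or.inl rfl⟩
  · rintro x rfl y hy hxy (h | h)
    · exact absurd h.symm (hσ x hv y hy hxy)
    · exact absurd h (hN y hy hxy)
  · rintro x rfl
    simp
  · intro x hx
    exact Function.update_of_ne hx _ _

/-- If `v` avoids the colours `a`, `b` or has no neighbour in `U`, then `U` is still closed in
`G[A]`. The colour of `v` under `σ'` is free, so the lemma also applies after `v` has been
recoloured. -/
theorem KempeMove.lift_of_not_adj [DecidableEq V] {A : Finset V} {v : V}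
    {σ σ' : V → Fin q} (hσσ' : ∀ x ∈ A.erase v, σ' x = σ x)
    {a b : Fin q} (hab : a ≠ b) {U : Set V}
    (hU : ∀ x ∈ U, x ∈ A.erase v ∧ (σ x = a ∨ σ x = b))
    (hcl : ∀ x ∈ U, ∀ y ∈ A.erase v, G.Adj x y → (σ y = a ∨ σ y = b) → y ∈ U)
    (hv : (σ' v = a ∨ σ' v = b) → ∀ x ∈ U, ¬ G.Adj x v)
    {τ : V → Fin q} (hin : ∀ x ∈ U, τ x = Equiv.swap a b (σ x)) (hout : ∀ x ∉ U, τ x = σ x) :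
    ∃ τ', KempeMove G A σ' τ' ∧ ∀ x ∈ A.erase v, τ' x = τ x := by
  classical
  refine ⟨fun x => if x ∈ U then Equiv.swap a b (σ' x) else σ' x, ⟨a, b, hab, U, ?_, ?_, ?_, ?_⟩, ?_⟩
  · intro x hx
    exact ⟨Finset.mem_of_mem_erase (hU x hx).1, by rw [hσσ' x (hU x hx).1]; exact (hU x hx).2⟩
  · intro x hx y hy hxy h
    by_cases hyv : y = v
    · subst hyv
      exact absurd hxy (hv h x hx)
    · have hy' : y ∈ A.erase v := Finset.mem_erase.2 ⟨hyv, hy⟩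
      exact hcl x hx y hy' hxy (by rwa [hσσ' y hy'] at h)
  · intro x hx
    simp [hx]
  · intro x hx
    simp [hx]
  · intro x hx
    by_cases hxU : x ∈ U
    · simp [hxU, hin x hxU, hσσ' x hx]
    · simp [hxU, hout x hxU, hσσ' x hx]

/-- The move fails to extend only when `v` links `U` to the rest of its two-coloured graph. Then two
neighbours of `v` share a colour, which leaves a spare colour to which `v` can be moved first. -/
theorem KempeMove.lift [DecidableEq V] [DecidableRel G.Adj] {A : Finset V} {v : V} (hvA : v ∈ A)
    (hdeg : (A.filter (G.Adj v)).card < q) {σ σ' τ : V → Fin q} (hσ' : ProperOn G A σ')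
    (hσσ' : ∀ x ∈ A.erase v, σ' x = σ x) (h : KempeMove G (A.erase v) σ τ) :
    ∃ τ', Relation.ReflTransGen (KempeMove G A) σ' τ' ∧ ProperOn G A τ' ∧
      ∀ x ∈ A.erase v, τ' x = τ x := by
  classical
  obtain ⟨a, b, hab, U, hU, hcl, hin, hout⟩ := h
  by_cases hI : (σ' v = a ∨ σ' v = b) → ∀ x ∈ U, ¬ G.Adj x v
  · obtain ⟨τ', h1, h2⟩ := KempeMove.lift_of_not_adj hσσ' hab hU hcl hI hin hout
    exact ⟨τ', .single h1, h1.properOn hσ', h2⟩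
  push Not at hI
  obtain ⟨hvab, x, hxU, hxv⟩ := hI
  -- If every neighbour of `v` coloured `a` or `b` lies in `U`, then `v` simply joins `U`.
  by_cases hII : ∀ y ∈ A.erase v, G.Adj v y → (σ y = a ∨ σ y = b) → y ∈ U
  · have h1 : KempeMove G A σ' (fun x => if x ∈ insert v U then Equiv.swap a b (σ' x) else σ' x) := by
      refine ⟨a, b, hab, insert v U, ?_, ?_, ?_, ?_⟩
      · rintro x (rfl | hx)
        · exact ⟨hvA, hvab⟩
        · exact ⟨Finset.mem_of_mem_erase (hU x hx).1, by rw [hσσ' x (hU x hx).1]; exact (hU x hx).2⟩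
      · intro x hx y hy hxy h
        by_cases hyv : y = v
        · exact Or.inl hyv
        · right
          have hy' : y ∈ A.erase v := Finset.mem_erase.2 ⟨hyv, hy⟩
          rw [hσσ' y hy'] at h
          rcases hx with rfl | hx
          · exact hII y hy' hxy h
          · exact hcl x hx y hy' hxy h
      · intro x hx
        exact if_pos hx
      · intro x hx
        exact if_neg hx
    refine ⟨_, .single h1, h1.properOn hσ', ?_⟩
    intro y hy
    have hyv : y ≠ v := Finset.ne_of_mem_erase hy
    by_cases hyU : y ∈ U
    · simp [hyU, hin y hyU, hσσ' y hy]
    · simp [hyU, hyv, hout y hyU, hσσ' y hy]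
  push Not at hII
  obtain ⟨y, hy, hvy, hyab, hyU⟩ := hII
  have hxe := (hU x hxU).1
  have hxA := Finset.mem_of_mem_erase hxe
  have hyA := Finset.mem_of_mem_erase hy
  have hxy : x ≠ y := fun h => hyU (h ▸ hxU)
  have hx1 := hσ' v hvA x hxA hxv.symm
  have hy1 := hσ' v hvA y hyA hvy
  have hxab := (hU x hxU).2
  rw [← hσσ' x hxe] at hxab
  rw [← hσσ' y hy] at hyab
  -- Both have the one colour among `a`, `b` that `v` does not have.
  have hcol : σ' x = σ' y := by grind
  obtain ⟨c, hc⟩ : ∃ c, c ∉ insert (σ' v) ((A.filter (G.Adj v)).image σ') := by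
    by_contra! hall
    -- Dropping `x` loses no colour, as `y` repeats it. So `v` and its neighbours use at most `1 +
    -- (deg - 1) < q` colours.
    have h1 : (Finset.univ : Finset (Fin q)) ⊆ insert (σ' v) (((A.filter (G.Adj v)).erase x).image σ') := by
      intro c _
      have := hall c
      rw [Finset.mem_insert, Finset.mem_image] at this ⊢
      rcases this with h | ⟨z, hz, rfl⟩
      · exact Or.inl h
      · right
        by_cases hzx : z = x
        · exact ⟨y, by simp [hxy.symm, hyA, hvy], by rw [hzx, hcol]⟩
        · exact ⟨z, Finset.mem_erase.2 ⟨hzx, hz⟩, rfl⟩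
    have h2 := Finset.card_le_card h1
    have h3 := Finset.card_insert_le (σ' v) (((A.filter (G.Adj v)).erase x).image σ')
    have h4 := Finset.card_image_le (s := (A.filter (G.Adj v)).erase x) (f := σ')
    have hxm : x ∈ A.filter (G.Adj v) := by simp [hxA, hxv.symm]
    rw [Finset.card_erase_of_mem hxm] at h4
    have h5 : 0 < (A.filter (G.Adj v)).card := Finset.card_pos.2 ⟨x, hxm⟩
    rw [Finset.card_univ, Fintype.card_fin] at h2
    omega
  simp only [Finset.mem_insert, Finset.mem_image, Finset.mem_filter, not_or, not_exists, not_and] at hc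
  have hm := kempeMove_update hvA hσ' hc.1 (fun y hy hvy => hc.2 y ⟨hy, hvy⟩)
  have hcx : c ≠ σ' x := fun h => hc.2 x ⟨hxA, hxv.symm⟩ h.symm
  -- The colours of `v` and `x` are exactly `a` and `b`, and `c` is neither.
  have hcab : ¬ (c = a ∨ c = b) := by
    have := hc.1
    grind
  obtain ⟨τ', h1, h2⟩ := KempeMove.lift_of_not_adj (G := G) (σ' := Function.update σ' v c)
    (fun x hx => by rw [Function.update_of_ne (Finset.ne_of_mem_erase hx), hσσ' x hx]) hab hU hcl
    (by simp [hcab]) hin hout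
  exact ⟨τ', .tail (.single hm) h1, h1.properOn (hm.properOn hσ'), h2⟩

/-- **Las Vergnas–Meyniel**: all proper `q`-colourings of a `(q - 1)`-degenerate graph are Kempe
equivalent. -/
theorem kempe_connected [DecidableRel G.Adj]
    (hdeg : ∀ A : Finset V, A.Nonempty → ∃ v ∈ A, (A.filter (G.Adj v)).card < q)
    (A : Finset V) {σ τ : V → Fin q} (hσ : ProperOn G A σ) (hτ : ProperOn G A τ) :
    ∃ τ', Relation.ReflTransGen (KempeMove G A) σ τ' ∧ ProperOn G A τ' ∧ ∀ x ∈ A, τ' x = τ x := by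
  classical
  induction hn : A.card generalizing A with
  | zero =>
    rw [Finset.card_eq_zero] at hn
    subst hn
    exact ⟨σ, .refl, hσ, by simp⟩
  | succ n ih =>
    obtain ⟨v, hvA, hv⟩ := hdeg A (Finset.card_pos.1 (by omega))
    have hsub : ∀ {ρ : V → Fin q}, ProperOn G A ρ → ProperOn G (A.erase v) ρ :=
      fun h x hx y hy => h x (Finset.mem_of_mem_erase hx) y (Finset.mem_of_mem_erase hy)
    obtain ⟨ρ, h1, -, h3⟩ := ih (A.erase v) (hsub hσ) (hsub hτ)
      (by rw [Finset.card_erase_of_mem hvA, hn]; rfl)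
    have hlift : ∃ ρ', Relation.ReflTransGen (KempeMove G A) σ ρ' ∧ ProperOn G A ρ' ∧
        ∀ x ∈ A.erase v, ρ' x = ρ x := by
      clear h3
      induction h1 with
      | refl => exact ⟨σ, .refl, hσ, fun _ _ => rfl⟩
      | tail _ hs ih2 =>
        obtain ⟨ρ', g1, g2, g3⟩ := ih2
        obtain ⟨τ', k1, k2, k3⟩ := hs.lift hvA hv g2 g3
        exact ⟨τ', g1.trans k1, k2, k3⟩
    obtain ⟨ρ', g1, g2, g3⟩ := hlift
    have hag : ∀ x ∈ A, x ≠ v → ρ' x = τ x := fun x hx hxv => by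
      have := Finset.mem_erase.2 ⟨hxv, hx⟩
      rw [g3 x this, h3 x this]
    by_cases hvv : τ v = ρ' v
    · refine ⟨ρ', g1, g2, fun x hx => ?_⟩
      by_cases hxv : x = v
      · rw [hxv, hvv]
      · exact hag x hx hxv
    -- Away from `v` the target is reached, and `τ` is proper, so `τ v` is absent from the
    -- neighbours of `v`.
    · have hm := kempeMove_update hvA g2 hvv (fun y hy hvy => by
        rw [hag y hy hvy.ne.symm]
        exact (hτ v hvA y hy hvy).symm)
      refine ⟨_, g1.tail hm, hm.properOn g2, fun x hx => ?_⟩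
      by_cases hxv : x = v
      · simp [hxv]
      · rw [Function.update_of_ne hxv, hag x hx hxv]

end Kempe

/-! ## Ergodicity -/

section Ergodic

variable {V : Type u} {G : SimpleGraph V} {q : ℕ}

theorem flipColouring_apply (σ : G.Coloring (Fin q)) (a b : Fin q) (s) (x : V) :
    flipColouring G σ a b s x = flipColour G σ a b s x := rfl

/-- Select the components that meet `U`; closedness of `U` puts each of them wholly inside `U`. -/
theorem KempeMove.exists_flipColouring [Fintype V] {σ τ : G.Coloring (Fin q)}
    (h : KempeMove G Finset.univ σ τ) : ∃ a b, a ≠ b ∧ ∃ s, flipColouring G σ a b s = τ := by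
  classical
  obtain ⟨a, b, hab, U, hU, hcl, hin, hout⟩ := h
  refine ⟨a, b, hab, fun c => decide (∃ x : {x : V | σ x = a ∨ σ x = b}, (x : V) ∈ U ∧
    (twoColourGraph G σ a b).connectedComponentMk x = c), ?_⟩
  have hreach : ∀ x y, (twoColourGraph G σ a b).Reachable x y → (x : V) ∈ U → (y : V) ∈ U := by
    rintro x y ⟨p⟩
    induction p with
    | nil => exact id
    | @cons _ v _ hxy _ ih =>
      exact fun hx => ih (hcl _ hx _ (Finset.mem_univ _) (by simpa using hxy) v.2)
  refine RelHom.ext fun x => ?_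
  rw [flipColouring_apply, flipColour]
  by_cases hx : σ x = a ∨ σ x = b
  · rw [dif_pos hx]
    by_cases hxU : x ∈ U
    · rw [if_pos, hin x hxU]
      simp only [decide_eq_true_eq]
      exact ⟨⟨x, hx⟩, hxU, rfl⟩
    · rw [if_neg, hout x hxU]
      simp only [decide_eq_true_eq]
      rintro ⟨y, hyU, hy⟩
      exact hxU (hreach y ⟨x, hx⟩ (SimpleGraph.ConnectedComponent.exact hy) hyU)
  · rw [dif_neg hx, hout x (fun h => hx (hU x h).2)]

theorem wskStep_flipColouring_ne_zero [Finite V] (hq : 2 ≤ q) (σ : G.Coloring (Fin q))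
    {a b : Fin q} (hab : a ≠ b) (s) : wskStep G hq σ (flipColouring G σ a b s) ≠ 0 := by
  rw [← PMF.mem_support_iff]
  unfold wskStep
  simp only [PMF.mem_support_bind_iff, PMF.mem_support_map_iff]
  exact ⟨⟨(a, b), hab⟩, by simp, s, by simp, rfl⟩

/-- All coins may say "leave unchanged". This laziness makes reachability monotone in the number of
steps. -/
theorem wskStep_self_ne_zero [Finite V] (hq : 2 ≤ q) (σ : G.Coloring (Fin q)) :
    wskStep G hq σ σ ≠ 0 := by
  have h := wskStep_flipColouring_ne_zero hq σ (a := ⟨0, by omega⟩) (b := ⟨1, by omega⟩)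
    (by simp) (fun _ => false)
  have h2 : flipColouring G σ ⟨0, by omega⟩ ⟨1, by omega⟩ (fun _ => false) = σ := by
    refine RelHom.ext fun x => ?_
    simp [flipColouring_apply, flipColour]
  rwa [h2] at h

theorem wskLaw_succ_ne_zero [Finite V] {hq : 2 ≤ q} {n : ℕ} {σ ρ τ : G.Coloring (Fin q)}
    (h1 : wskLaw G hq n σ ρ ≠ 0) (h2 : wskStep G hq ρ τ ≠ 0) : wskLaw G hq (n + 1) σ τ ≠ 0 := by
  rw [← PMF.mem_support_iff] at *
  rw [wskLaw, PMF.mem_support_bind_iff]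
  exact ⟨ρ, h1, h2⟩

theorem wskLaw_ne_zero_of_le [Finite V] {hq : 2 ≤ q} {m n : ℕ} (hmn : m ≤ n)
    {σ τ : G.Coloring (Fin q)} (h : wskLaw G hq m σ τ ≠ 0) : wskLaw G hq n σ τ ≠ 0 := by
  induction n, hmn using Nat.le_induction with
  | base => exact h
  | succ n _ ih => exact wskLaw_succ_ne_zero ih (wskStep_self_ne_zero hq τ)

/-- The WSK algorithm is ergodic on `(q - 1)`-degenerate graphs. -/
theorem wskErgodic_of_degenerate [Fintype V] [DecidableRel G.Adj] (hq : 2 ≤ q)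
    (hdeg : ∀ A : Finset V, A.Nonempty → ∃ v ∈ A, (A.filter (G.Adj v)).card < q) :
    WSKErgodic G q := by
  classical
  have hprop : ∀ σ : G.Coloring (Fin q), ProperOn G Finset.univ σ :=
    fun σ x _ y _ hxy => σ.valid hxy
  have hex : ∀ σ τ : G.Coloring (Fin q), ∃ n, wskLaw G hq n σ τ ≠ 0 := by
    intro σ τ
    obtain ⟨τ', h1, h2, h3⟩ := kempe_connected hdeg Finset.univ (hprop σ) (hprop τ)
    have h4 : τ' = τ := funext fun x => h3 x (Finset.mem_univ x)
    subst h4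
    suffices ∀ ρ : V → Fin q, Relation.ReflTransGen (KempeMove G Finset.univ) σ ρ →
        ∃ ρ' : G.Coloring (Fin q), ⇑ρ' = ρ ∧ ∃ n, wskLaw G hq n σ ρ' ≠ 0 by
      obtain ⟨ρ', h5, h6⟩ := this _ h1
      rwa [DFunLike.coe_injective h5] at h6
    intro ρ hρ
    induction hρ with
    | refl => exact ⟨σ, rfl, 0, by simp [wskLaw]⟩
    | @tail ρ₁ ρ₂ _ hs ih =>
      obtain ⟨ρ₁, rfl, n, hn⟩ := ih
      have h2 := hs.properOn (hprop ρ₁)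
      let ρ' : G.Coloring (Fin q) := SimpleGraph.Coloring.mk ρ₂
        (fun {x y} hxy => h2 x (Finset.mem_univ x) y (Finset.mem_univ y) hxy)
      obtain ⟨a, b, hab, s, hs'⟩ := KempeMove.exists_flipColouring (τ := ρ') hs
      refine ⟨ρ', rfl, n + 1, wskLaw_succ_ne_zero hn ?_⟩
      rw [← hs']
      exact wskStep_flipColouring_ne_zero hq ρ₁ hab s
  choose n hn using hex
  have : Finite (G.Coloring (Fin q)) := DFunLike.finite _
  have := Fintype.ofFinite (G.Coloring (Fin q))
  refine ⟨hq, Finset.univ.sup fun p : G.Coloring (Fin q) × G.Coloring (Fin q) => n p.1 p.2, ?_⟩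
  intro m hm σ τ
  refine pos_iff_ne_zero.2 (wskLaw_ne_zero_of_le ?_ (hn σ τ))
  exact le_trans (Finset.le_sup (f := fun p : G.Coloring (Fin q) × G.Coloring (Fin q) => n p.1 p.2)
    (Finset.mem_univ (σ, τ))) hm

end Ergodic

/-! ## Incidence maps -/

section Incidence

variable {α β γ : Type*}

/-- The coboundary `c ↦ c ∘ p - c ∘ q`. -/
def diffMap (p q : α → β) : (β → ℚ) →ₗ[ℚ] (α → ℚ) :=
  LinearMap.funLeft ℚ ℚ p - LinearMap.funLeft ℚ ℚ q

@[simp]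
theorem diffMap_apply (p q : α → β) (c : β → ℚ) (a : α) : diffMap p q c a = c (p a) - c (q a) := rfl

open Classical in
/-- The boundary, adjoint to `diffMap p q`. -/
noncomputable def sumMap [Fintype α] (p q : α → β) : (α → ℚ) →ₗ[ℚ] (β → ℚ) where
  toFun x b := ∑ a, x a * ((if p a = b then 1 else 0) - if q a = b then 1 else 0)
  map_add' x y := by
    ext b
    simp [add_mul, Finset.sum_add_distrib]
  map_smul' c x := by
    ext b
    simp [Finset.mul_sum, mul_assoc]

open Classical in
theorem sumMap_apply [Fintype α] (p q : α → β) (x : α → ℚ) (b : β) :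
    sumMap p q x b = ∑ a, x a * ((if p a = b then 1 else 0) - if q a = b then 1 else 0) := rfl

/-- The two maps have transposed matrices. -/
theorem finrank_range_sumMap [Fintype α] [Fintype β] (p q : α → β) :
    Module.finrank ℚ (LinearMap.range (sumMap p q)) =
      Module.finrank ℚ (LinearMap.range (diffMap p q)) := by
  classical
  let M : Matrix α β ℚ := fun a b => (if p a = b then 1 else 0) - if q a = b then 1 else 0
  have h1 : diffMap p q = M.mulVecLin := by
    refine LinearMap.ext fun c => funext fun a => ?_
    rw [Matrix.mulVecLin_apply, Matrix.mulVec, dotProduct]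
    simp [M, sub_mul, Finset.sum_sub_distrib]
  have h2 : sumMap p q = M.transpose.mulVecLin := by
    refine LinearMap.ext fun c => funext fun b => ?_
    rw [Matrix.mulVecLin_apply, Matrix.mulVec, dotProduct]
    exact Finset.sum_congr rfl fun a _ => mul_comm _ _
  have := M.rank_transpose
  rw [h1, h2]
  exact this

/-- Constant functions lie in the kernel; for empty `β` the truncated bound is `0`, which still
holds. -/
theorem finrank_range_diffMap_le [Finite α] [Fintype β] (p q : α → β) :
    Module.finrank ℚ (LinearMap.range (diffMap p q)) ≤ Fintype.card β - 1 := by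
  have h := LinearMap.finrank_range_add_finrank_ker (diffMap p q)
  rw [Module.finrank_fintype_fun_eq_card] at h
  rcases isEmpty_or_nonempty β with hβ | hβ
  · have := Fintype.card_eq_zero (α := β)
    omega
  · have hk : (fun _ => 1 : β → ℚ) ∈ LinearMap.ker (diffMap p q) := by
      rw [LinearMap.mem_ker]
      ext a
      simp
    have : 0 < Module.finrank ℚ (LinearMap.ker (diffMap p q)) := by
      rw [Module.finrank_pos_iff_exists_ne_zero]
      refine ⟨⟨_, hk⟩, fun h0 => ?_⟩
      obtain ⟨b⟩ := hβ
      exact one_ne_zero (congrFun (congrArg Subtype.val h0) b)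
    omega

end Incidence

/-! ## Subgraphs of a cell complex -/

section Complex

variable {E V F : Type*} [Fintype E]

/-- Passage from cohomology to homology: by rank-nullity for both boundary maps and equality of
transposed ranks, the bound on cocycles modulo coboundaries becomes the same bound on cycles modulo
face boundaries. -/
theorem finrank_ker_sumMap_le [Fintype V] [Fintype F] {head tail : E → V} {left right : E → F} {h : ℕ}
    (hH : Module.finrank ℚ (LinearMap.ker (sumMap left right)) ≤
      Module.finrank ℚ (LinearMap.range (diffMap head tail)) + h) :
    Module.finrank ℚ (LinearMap.ker (sumMap head tail)) ≤
      Module.finrank ℚ (LinearMap.range (diffMap left right)) + h := by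
  have h1 := LinearMap.finrank_range_add_finrank_ker (sumMap left right)
  have h2 := LinearMap.finrank_range_add_finrank_ker (sumMap head tail)
  rw [finrank_range_sumMap] at h1 h2
  omega

/-- Two faces are merged when an edge between them is deleted. -/
def MergedBy (left right : E → F) (K : Finset E) (i j : F) : Prop :=
  ∃ e ∉ K, left e = i ∧ right e = j

/-- The faces that remain after the deletion of the edges outside `K`. -/
abbrev MergedFace (left right : E → F) (K : Finset E) : Type _ := Quot (MergedBy left right K)

/-- The edges between different merged faces. -/
noncomputable def properEdges (left right : E → F) (K : Finset E) : Finset E :=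
  open Classical in Finset.univ.filter fun e =>
    (Quot.mk _ (left e) : MergedFace left right K) ≠ Quot.mk _ (right e)

theorem mem_properEdges {left right : E → F} {K : Finset E} {e : E} :
    e ∈ properEdges left right K ↔
      (Quot.mk _ (left e) : MergedFace left right K) ≠ Quot.mk _ (right e) := by
  simp [properEdges]

theorem properEdges_subset (left right : E → F) (K : Finset E) : properEdges left right K ⊆ K := by
  intro e he
  rw [mem_properEdges] at he
  by_contra hK
  exact he (Quot.sound ⟨e, hK, rfl, rfl⟩)

/-- The boundary edges of a merged face. -/
noncomputable def boundaryEdges (left right : E → F) (K : Finset E) (c : MergedFace left right K) :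
    Finset E :=
  open Classical in (properEdges left right K).filter fun e => Quot.mk _ (left e) = c ∨ Quot.mk _ (right e) = c

theorem mem_boundaryEdges {left right : E → F} {K : Finset E} {c : MergedFace left right K} {e : E} :
    e ∈ boundaryEdges left right K c ↔ e ∈ properEdges left right K ∧
      (Quot.mk _ (left e) = c ∨ Quot.mk _ (right e) = c) := by
  simp [boundaryEdges]

/-- The merged faces with nonempty boundary. -/
abbrev ProperFace (left right : E → F) (K : Finset E) : Type _ :=
  {c : MergedFace left right K // (boundaryEdges left right K c).Nonempty}

-- Let `Z` be the cycles supported on `K` and `B` the face boundaries. Then `dim Z ≥ |K| - (|A| -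
-- 1)`, while `Z + B` consists of cycles, so `dim Z ≤ h + dim (Z ∩ B)`. An element of `Z ∩ B` comes
-- from a potential that is constant on merged faces, which bounds `dim (Z ∩ B)` by the number of
-- proper faces minus one.
open Classical in
theorem card_add_one_le [Fintype V] [Fintype F] {head tail : E → V} {left right : E → F} {h : ℕ}
    (hH : Module.finrank ℚ (LinearMap.ker (sumMap left right)) ≤
      Module.finrank ℚ (LinearMap.range (diffMap head tail)) + h)
    (hc : ∀ w, sumMap head tail (diffMap left right w) = 0)
    (K : Finset E) (A : Finset V) (hA : A.Nonempty) (hhead : ∀ e ∈ K, head e ∈ A)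
    (htail : ∀ e ∈ K, tail e ∈ A) :
    K.card + 1 ≤ A.card + h + (Nat.card (ProperFace left right K) - 1) := by
  let hd : K → A := fun e => ⟨head e, hhead e e.2⟩
  let tl : K → A := fun e => ⟨tail e, htail e e.2⟩
  let ext : (K → ℚ) →ₗ[ℚ] (E → ℚ) := Function.ExtendByZero.linearMap ℚ (Subtype.val : K → E)
  have hext : ∀ x (e : K), ext x e = x e := fun x e => Subtype.val_injective.extend_apply _ _ _
  have hext0 : ∀ x (e : E), e ∉ K → ext x e = 0 := fun x e he =>
    Function.extend_apply' _ _ _ (by rintro ⟨a, rfl⟩; exact he a.2)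
  have hinj : Function.Injective ext := fun x y hxy => funext fun e => by
    rw [← hext x e, hxy, hext]
  let Z := (LinearMap.ker (sumMap hd tl)).map ext
  have hZ1 : Z ≤ LinearMap.ker (sumMap head tail) := by
    rintro _ ⟨x, hx, rfl⟩
    rw [LinearMap.mem_ker]
    ext v
    rw [sumMap_apply, Pi.zero_apply]
    have hs : ∑ e, ext x e * ((if head e = v then 1 else 0) - if tail e = v then 1 else 0) =
        ∑ e : K, x e * ((if head e = v then 1 else 0) - if tail e = v then 1 else 0) := by
      rw [← Finset.sum_subset (Finset.subset_univ K), ← Finset.sum_coe_sort]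
      · exact Finset.sum_congr rfl fun e _ => by rw [hext]
      · intro e _ he
        rw [hext0 x e he, zero_mul]
    rw [hs]
    by_cases hv : v ∈ A
    · have := congrFun (LinearMap.mem_ker.1 hx) ⟨v, hv⟩
      rw [sumMap_apply] at this
      simpa [hd, tl] using this
    · refine Finset.sum_eq_zero fun e _ => ?_
      rw [if_neg, if_neg, sub_zero, mul_zero]
      · rintro rfl
        exact hv (htail e e.2)
      · rintro rfl
        exact hv (hhead e e.2)
  have hZ2 : K.card ≤ Module.finrank ℚ Z + (A.card - 1) := by
    have h1 := LinearMap.finrank_range_add_finrank_ker (sumMap hd tl)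
    rw [Module.finrank_fintype_fun_eq_card, finrank_range_sumMap] at h1
    have h2 := finrank_range_diffMap_le hd tl
    have h3 : Module.finrank ℚ Z = Module.finrank ℚ (LinearMap.ker (sumMap hd tl)) :=
      (Submodule.equivMapOfInjective ext hinj _).finrank_eq.symm
    simp only [Fintype.card_coe] at h1 h2
    omega
  let B := LinearMap.range (diffMap left right)
  have hB : B ≤ LinearMap.ker (sumMap head tail) := by
    rintro _ ⟨w, rfl⟩
    exact hc w
  have h1 := Submodule.finrank_sup_add_finrank_inf_eq Z B
  have h2 := Submodule.finrank_mono (sup_le hZ1 hB)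
  have h3 := finrank_ker_sumMap_le hH
  have hA' := hA.card_pos
  let Ed := {e // e ∈ properEdges left right K}
  have hpl : ∀ e : Ed, (boundaryEdges left right K (Quot.mk _ (left e))).Nonempty :=
    fun e => ⟨e, mem_boundaryEdges.2 ⟨e.2, Or.inl rfl⟩⟩
  have hpr : ∀ e : Ed, (boundaryEdges left right K (Quot.mk _ (right e))).Nonempty :=
    fun e => ⟨e, mem_boundaryEdges.2 ⟨e.2, Or.inr rfl⟩⟩
  let l' : Ed → ProperFace left right K := fun e => ⟨_, hpl e⟩
  let r' : Ed → ProperFace left right K := fun e => ⟨_, hpr e⟩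
  let res : (E → ℚ) →ₗ[ℚ] (Ed → ℚ) := LinearMap.funLeft ℚ ℚ Subtype.val
  -- The boundary vanishes off `K`, so the face potential agrees across each deleted edge and
  -- descends to merged faces.
  have hlift : ∀ x ∈ Z ⊓ B, ∃ w : MergedFace left right K → ℚ,
      ∀ e, x e = w (Quot.mk _ (left e)) - w (Quot.mk _ (right e)) := by
    rintro x ⟨⟨y, -, hy⟩, w, rfl⟩
    refine ⟨Quot.lift w ?_, fun e => rfl⟩
    rintro _ _ ⟨e, he, rfl, rfl⟩
    have := hext0 y e he
    rw [hy] at this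
    exact sub_eq_zero.1 this
  have hresinj : Set.InjOn res (Z ⊓ B : Submodule ℚ (E → ℚ)) := by
    intro x hx y hy hxy
    ext e
    by_cases he : e ∈ properEdges left right K
    · exact congrFun hxy ⟨e, he⟩
    · obtain ⟨w, hw⟩ := hlift x hx
      obtain ⟨w', hw'⟩ := hlift y hy
      rw [mem_properEdges, not_not] at he
      rw [hw, hw', he, sub_self, sub_self]
  have hfr : Module.finrank ℚ (Z ⊓ B : Submodule ℚ (E → ℚ)) ≤
      Module.finrank ℚ (LinearMap.range (diffMap l' r')) := by
    refine LinearMap.finrank_le_finrank_of_injective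
      (f := (res.restrict (p := Z ⊓ B) (q := LinearMap.range (diffMap l' r')) ?_)) ?_
    · intro x hx
      obtain ⟨w, hw⟩ := hlift x hx
      exact ⟨fun c => w c.1, funext fun e => (hw e).symm⟩
    · intro x y hxy
      exact Subtype.ext (hresinj x.2 y.2 (congrArg Subtype.val hxy))
  have hpf : Finite (ProperFace left right K) := inferInstance
  have := Fintype.ofFinite (ProperFace left right K)
  have h4 := finrank_range_diffMap_le l' r'
  rw [← Nat.card_eq_fintype_card] at h4
  change _ ≤ Module.finrank ℚ B + h at h3
  omega

/-- Double counting: an edge bounds at most two merged faces. -/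
theorem mul_card_properFace_le [Finite F] (left right : E → F) (K : Finset E) {g : ℕ}
    (hg : ∀ c, (boundaryEdges left right K c).Nonempty → g ≤ (boundaryEdges left right K c).card) :
    g * Nat.card (ProperFace left right K) ≤ 2 * K.card := by
  classical
  have hpf : Finite (ProperFace left right K) := inferInstance
  have := Fintype.ofFinite (ProperFace left right K)
  calc g * Nat.card (ProperFace left right K)
      = ∑ _c : ProperFace left right K, g := by
        rw [Finset.sum_const, Finset.card_univ, Nat.card_eq_fintype_card, smul_eq_mul, mul_comm]
    _ ≤ ∑ c : ProperFace left right K, (boundaryEdges left right K c).card :=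
        Finset.sum_le_sum fun c _ => hg c.1 c.2
    _ = ∑ e ∈ properEdges left right K, (Finset.univ.filter fun c : ProperFace left right K =>
          Quot.mk _ (left e) = c.1 ∨ Quot.mk _ (right e) = c.1).card := by
        simp only [boundaryEdges, Finset.card_filter]
        rw [Finset.sum_comm]
    _ ≤ ∑ e ∈ properEdges left right K, 2 := by
        refine Finset.sum_le_sum fun e _ => ?_
        rw [← Finset.card_map ⟨Subtype.val, Subtype.val_injective⟩]
        refine (Finset.card_le_card (t := {Quot.mk _ (left e), Quot.mk _ (right e)}) ?_).trans
          Finset.card_le_two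
        intro c
        simp only [Finset.mem_map, Finset.mem_filter, Finset.mem_univ, true_and]
        rintro ⟨c, hc, rfl⟩
        rcases hc with hc | hc
        · simp [hc]
        · simp [hc]
    _ ≤ 2 * K.card := by
        rw [Finset.sum_const, smul_eq_mul, mul_comm]
        exact Nat.mul_le_mul_left _ (Finset.card_le_card (properEdges_subset _ _ _))

end Complex

/-! ## Cycles in boundaries -/

/-- The start of a longest path is a leaf: another neighbour would extend the path or close a cycle.
-/
theorem SimpleGraph.IsAcyclic.exists_leaf {V : Type*} [Finite V] {G : SimpleGraph V}
    (h : G.IsAcyclic) {a b : V} (hab : G.Adj a b) : ∃ v, ∃! w, G.Adj v w := by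
  have : Nonempty V := ⟨a⟩
  have : Finite G.edgeSet := inferInstance
  obtain ⟨u, v, p, hp, hmax⟩ :=
    SimpleGraph.Walk.exists_isPath_forall_isPath_length_le_length G
  have hnil : ¬ p.Nil := by
    intro hn
    have h1 := hmax a b (.cons hab .nil) (by simpa using hab.ne)
    have h2 := SimpleGraph.Walk.length_eq_zero_iff.2 hn
    simp [h2] at h1
  refine ⟨u, _, p.adj_snd hnil, fun w hadj ↦ ?_⟩
  apply h.eq_snd_of_adj_start hp hadj
  have : ¬(p.cons hadj.symm).IsPath := by grind [SimpleGraph.Walk.length_cons]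
  grind [hp.cons]

section Boundary

variable {E V F : Type*} [Fintype E] [Fintype V]

/-- The boundary of the indicator of `c` is a cycle with coefficients `±1` exactly on the boundary
edges. In a forest it could not cancel at a leaf, so these edges contain a graph cycle, of length at
least `g`. -/
theorem le_card_boundaryEdges {head tail : E → V} {left right : E → F}
    (hc : ∀ w, sumMap head tail (diffMap left right w) = 0)
    (hends : Function.Injective fun e => s(head e, tail e)) {K : Finset E} {Γ : SimpleGraph V}
    (hΓ : ∀ e ∈ K, Γ.Adj (head e) (tail e)) {g : ℕ} (hg : (g : ℕ∞) ≤ Γ.egirth)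
    (c : MergedFace left right K) (hne : (boundaryEdges left right K c).Nonempty) :
    g ≤ (boundaryEdges left right K c).card := by
  classical
  set S := boundaryEdges left right K c with hS
  have hSK : ∀ e ∈ S, e ∈ K := fun e he =>
    properEdges_subset _ _ _ (mem_boundaryEdges.1 he).1
  let Γ' := SimpleGraph.fromEdgeSet (S.image (fun e => s(head e, tail e)) : Set (Sym2 V))
  have hadj : ∀ v w, Γ'.Adj v w ↔ ∃ e ∈ S, s(head e, tail e) = s(v, w) := by
    intro v w
    simp only [Γ', SimpleGraph.fromEdgeSet_adj, Finset.coe_image, Set.mem_image, Finset.mem_coe]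
    refine ⟨fun h => h.1, fun h => ⟨h, ?_⟩⟩
    obtain ⟨e, he, hvw⟩ := h
    have := (hΓ e (hSK e he)).ne
    rw [Sym2.eq_iff] at hvw
    grind
  have hle : Γ' ≤ Γ := by
    intro v w hvw
    obtain ⟨e, he, h⟩ := (hadj v w).1 hvw
    have := hΓ e (hSK e he)
    rwa [← SimpleGraph.mem_edgeSet, h, SimpleGraph.mem_edgeSet] at this
  have hcyc : ¬ Γ'.IsAcyclic := by
    intro hac
    obtain ⟨e₀, he₀⟩ := hne
    obtain ⟨v, w, hvw, huniq⟩ := hac.exists_leaf ((hadj _ _).2 ⟨e₀, he₀, rfl⟩)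
    obtain ⟨e, he, hevw⟩ := (hadj v w).1 hvw
    let ind : F → ℚ := fun i => if (Quot.mk _ i : MergedFace left right K) = c then 1 else 0
    have hzero := congrFun (hc ind) v
    rw [sumMap_apply, Finset.sum_eq_single e] at hzero
    · have hp := mem_boundaryEdges.1 he
      rw [mem_properEdges] at hp
      have hne' := (hΓ e (hSK e he)).ne
      rw [Pi.zero_apply, mul_eq_zero] at hzero
      rcases hzero with h0 | h0
      · simp only [diffMap_apply, ind] at h0
        grind
      · rw [Sym2.eq_iff] at hevw
        grind
    -- Other edges contribute nothing at `v`: a boundary edge there would join the leaf to its only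
    -- neighbour and so equal `e`, and off the boundary the coefficient is zero.
    · intro e' _ hee'
      by_cases he' : e' ∈ S
      · rw [if_neg, if_neg, sub_zero, mul_zero]
        · intro h
          have hw := huniq (head e') ((hadj _ _).2 ⟨e', he', by rw [h, Sym2.eq_swap]⟩)
          refine hee' (hends ?_)
          simp only
          rw [hevw, h, ← hw, Sym2.eq_swap]
        · intro h
          have hw := huniq (tail e') ((hadj _ _).2 ⟨e', he', by rw [h]⟩)
          refine hee' (hends ?_)
          simp only
          rw [hevw, h, ← hw]
      · have : diffMap left right ind e' = 0 := by
          rw [hS, mem_boundaryEdges, mem_properEdges] at he'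
          simp only [diffMap_apply, ind]
          grind
        rw [this, zero_mul]
    · simp
  rw [SimpleGraph.IsAcyclic] at hcyc
  push Not at hcyc
  obtain ⟨v, p, hp⟩ := hcyc
  have h1 : (g : ℕ∞) ≤ p.length :=
    (hg.trans (SimpleGraph.egirth_anti hle)).trans (SimpleGraph.egirth_le_length hp)
  have h2 : g ≤ p.length := by exact_mod_cast h1
  refine h2.trans ?_
  rw [← SimpleGraph.Walk.length_edges, ← List.toFinset_card_of_nodup hp.isTrail.edges_nodup]
  refine (Finset.card_le_card (t := S.image fun e => s(head e, tail e)) ?_).trans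
    Finset.card_image_le
  intro x hx
  have := p.edges_subset_edgeSet (List.mem_toFinset.1 hx)
  simp only [Γ', SimpleGraph.edgeSet_fromEdgeSet] at this
  exact_mod_cast this.1

end Boundary

/-! ## Circle-valued functions -/

section CircleValued

theorem exists_real_lift {X : Type*} [TopologicalSpace X] [SimplyConnectedSpace X]
    [LocallyPathConnectedSpace X] (g : C(X, UnitAddCircle)) :
    ∃ G : C(X, ℝ), ∀ x, (G x : UnitAddCircle) = g x := by
  obtain ⟨x₀⟩ : Nonempty X := inferInstance
  obtain ⟨r, hr⟩ := QuotientAddGroup.mk_surjective (g x₀)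
  obtain ⟨G, ⟨-, hG⟩, -⟩ :=
    (AddCircle.isCoveringMap_coe (1 : ℝ)).existsUnique_continuousMap_lifts g x₀ r hr
  exact ⟨G, fun x => congrFun hG x⟩

/-- A continuous integer-valued function on a preconnected space is constant. This is what controls
the differences of lifts. -/
theorem eq_of_coe_eq_zero {X : Type*} [TopologicalSpace X] [PreconnectedSpace X] {D : X → ℝ}
    (hD : Continuous D) (h0 : ∀ x, (D x : UnitAddCircle) = 0) (x y : X) : D x = D y := by
  refine isPreconnected_univ.constant_of_mapsTo (S := Set.univ)
    (T := Set.range ((↑) : ℤ → ℝ)) ?_ hD.continuousOn ?_ (Set.mem_univ x) (Set.mem_univ y)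
  · exact Int.isClosedEmbedding_coe_real.isInducing.isDiscrete_range
  intro x _
  obtain ⟨n, hn⟩ := (AddCircle.coe_eq_zero_iff (1 : ℝ)).1 (h0 x)
  exact ⟨n, by simpa using hn⟩

theorem exists_int_of_coe_eq_zero {x : ℝ} (h : (x : UnitAddCircle) = 0) : ∃ n : ℤ, x = n := by
  obtain ⟨n, hn⟩ := (AddCircle.coe_eq_zero_iff (1 : ℝ)).1 h
  exact ⟨n, by simpa using hn.symm⟩

theorem coe_int_eq_zero (n : ℤ) : ((n : ℝ) : UnitAddCircle) = 0 :=
  (AddCircle.coe_eq_zero_iff (1 : ℝ)).2 ⟨n, by simp⟩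

/-- Continuous maps on a compact space descend along surjections to Hausdorff spaces. -/
theorem exists_continuousMap_comp_eq {Y S Z : Type*} [TopologicalSpace Y] [CompactSpace Y]
    [TopologicalSpace S] [T2Space S] [TopologicalSpace Z] {P : Y → S} (hP : Continuous P)
    (hsurj : Function.Surjective P) {u : Y → Z} (hu : Continuous u)
    (h : ∀ x y, P x = P y → u x = u y) : ∃ v : C(S, Z), ∀ y, v (P y) = u y := by
  have hq : Topology.IsQuotientMap P := hP.isClosedMap.isQuotientMap hP hsurj
  have hf : Function.FactorsThrough (⟨u, hu⟩ : C(Y, Z)) (⟨P, hP⟩ : C(Y, S)) := fun x y hxy => h x y hxy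
  exact ⟨hq.lift (f := ⟨P, hP⟩) ⟨u, hu⟩ hf, fun y => DFunLike.congr_fun (hq.lift_comp _ hf) y⟩

/-- The rank of `[S, ℝ/ℤ]`, the group of circle valued functions modulo those that lift to `ℝ`,
is at most `h`. -/
def CircleRankLE (S : Type) [TopologicalSpace S] (h : ℕ) : Prop :=
  ∃ W : C(S, UnitAddCircle) →+ (Fin h → ℤ), ∀ g, W g = 0 →
    ∃ G : C(S, ℝ), ∀ x, (G x : UnitAddCircle) = g x

/-! ### Circle-valued maps on the sphere -/

/-- Spherical coordinates. -/
noncomputable def sphericalCoord (p : ℝ × ℝ) : Metric.sphere (0 : EuclideanSpace ℝ (Fin 3)) 1 :=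
  ⟨!₂[Real.sin p.2 * Real.cos p.1, Real.sin p.2 * Real.sin p.1, Real.cos p.2], by
    rw [mem_sphere_zero_iff_norm, EuclideanSpace.norm_eq, Fin.sum_univ_three, Real.sqrt_eq_one]
    simp only [Real.norm_eq_abs, sq_abs]
    simp
    nlinarith [Real.sin_sq_add_cos_sq p.1, Real.sin_sq_add_cos_sq p.2]⟩

theorem continuous_sphericalCoord : Continuous sphericalCoord := by
  unfold sphericalCoord
  fun_prop

theorem sphericalCoord_eq_iff {p p' : ℝ × ℝ} : sphericalCoord p = sphericalCoord p' ↔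
    Real.sin p.2 * Real.cos p.1 = Real.sin p'.2 * Real.cos p'.1 ∧
    Real.sin p.2 * Real.sin p.1 = Real.sin p'.2 * Real.sin p'.1 ∧ Real.cos p.2 = Real.cos p'.2 := by
  unfold sphericalCoord
  rw [Subtype.mk.injEq]
  constructor
  · intro h
    have h0 := congrArg (fun v : EuclideanSpace ℝ (Fin 3) => v 0) h
    have h1 := congrArg (fun v : EuclideanSpace ℝ (Fin 3) => v 1) h
    have h2 := congrArg (fun v : EuclideanSpace ℝ (Fin 3) => v 2) h
    exact ⟨by simpa using h0, by simpa using h1, by simpa using h2⟩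
  · rintro ⟨h0, h1, h2⟩
    rw [h0, h1, h2]

theorem exists_sphericalCoord_eq (x : Metric.sphere (0 : EuclideanSpace ℝ (Fin 3)) 1) :
    ∃ p ∈ Set.Icc (-Real.pi) Real.pi ×ˢ Set.Icc 0 Real.pi, sphericalCoord p = x := by
  obtain ⟨x, hx⟩ := x
  have hx' : x 0 ^ 2 + x 1 ^ 2 + x 2 ^ 2 = 1 := by
    rw [mem_sphere_zero_iff_norm, EuclideanSpace.norm_eq, Fin.sum_univ_three, Real.sqrt_eq_one] at hx
    simpa using hx
  let w : ℂ := ⟨x 0, x 1⟩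
  have hz1 : -1 ≤ x 2 := by nlinarith [sq_nonneg (x 0), sq_nonneg (x 1)]
  have hz2 : x 2 ≤ 1 := by nlinarith [sq_nonneg (x 0), sq_nonneg (x 1)]
  have hw : ‖w‖ = Real.sin (Real.arccos (x 2)) := by
    rw [Real.sin_arccos, Complex.norm_eq_sqrt_sq_add_sq]
    congr 1
    simp only [w]
    linarith
  refine ⟨(w.arg, Real.arccos (x 2)), ⟨⟨(Complex.neg_pi_lt_arg w).le, Complex.arg_le_pi w⟩,
    Real.arccos_nonneg _, Real.arccos_le_pi _⟩, Subtype.ext ?_⟩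
  ext i
  fin_cases i
  · have := Complex.norm_mul_cos_arg w
    rw [hw] at this
    exact this
  · have := Complex.norm_mul_sin_arg w
    rw [hw] at this
    exact this
  · simp [sphericalCoord, Real.cos_arccos hz1 hz2]

theorem circleRankLE_sphere : CircleRankLE (Metric.sphere (0 : EuclideanSpace ℝ (Fin 3)) 1) 0 := by
  refine ⟨0, fun g _ => ?_⟩
  obtain ⟨G, hG⟩ := exists_real_lift (g.comp ⟨sphericalCoord, continuous_sphericalCoord⟩)
  have hG' : ∀ p p', sphericalCoord p = sphericalCoord p' → ((G p - G p' : ℝ) : UnitAddCircle) = 0 := by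
    intro p p' h
    rw [AddCircle.coe_sub, hG, hG, ContinuousMap.comp_apply, ContinuousMap.comp_apply]
    simp only [ContinuousMap.coe_mk, h, sub_self]
  have hpole : ∀ φ, Real.sin φ = 0 → ∀ θ θ', G (θ, φ) = G (θ', φ) := by
    intro φ hφ θ θ'
    have := eq_of_coe_eq_zero (D := fun θ => G (θ, φ) - G (0, φ)) (by fun_prop)
      (fun θ => hG' _ _ (by simp [sphericalCoord_eq_iff, hφ])) θ θ'
    simpa using this
  -- The increment over `2π` is one integer for all points, and it vanishes at the pole `φ = 0`,
  -- where the lift does not depend on the longitude.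
  have hper : ∀ φ, Function.Periodic (fun θ => G (θ, φ)) (2 * Real.pi) := by
    intro φ θ
    have := eq_of_coe_eq_zero (D := fun p : ℝ × ℝ => G (p.1 + 2 * Real.pi, p.2) - G p) (by fun_prop)
      (fun p => hG' _ _ (by simp [sphericalCoord_eq_iff])) (θ, φ) (0, 0)
    simp only [hpole 0 Real.sin_zero (0 + 2 * Real.pi) 0, sub_self] at this
    exact sub_eq_zero.1 this
  have : CompactSpace (Set.Icc (-Real.pi) Real.pi ×ˢ Set.Icc 0 Real.pi : Set (ℝ × ℝ)) :=
    isCompact_iff_compactSpace.1 (isCompact_Icc.prod isCompact_Icc)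
  obtain ⟨v, hv⟩ := exists_continuousMap_comp_eq
    (Y := (Set.Icc (-Real.pi) Real.pi ×ˢ Set.Icc 0 Real.pi : Set (ℝ × ℝ)))
    (P := fun p => sphericalCoord p) (continuous_sphericalCoord.comp continuous_subtype_val)
    (fun x => by
      obtain ⟨p, hp, h⟩ := exists_sphericalCoord_eq x
      exact ⟨⟨p, hp⟩, h⟩) (u := fun p => G p) (by fun_prop) (by
      rintro ⟨⟨θ, φ⟩, _, hφ⟩ ⟨⟨θ', φ'⟩, _, hφ'⟩ h
      obtain ⟨h0, h1, h2⟩ := sphericalCoord_eq_iff.1 h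
      obtain rfl : φ = φ' := Real.injOn_cos hφ hφ' h2
      by_cases hs : Real.sin φ = 0
      · exact hpole φ hs θ θ'
      · have hc : Real.cos θ = Real.cos θ' := mul_left_cancel₀ hs h0
        have hs : Real.sin θ = Real.sin θ' := mul_left_cancel₀ hs h1
        obtain ⟨n, hn⟩ := Real.Angle.angle_eq_iff_two_pi_dvd_sub.1 (Real.Angle.cos_sin_inj hc hs)
        have := (hper φ).int_mul n θ'
        obtain rfl : θ = θ' + n * (2 * Real.pi) := by linarith
        exact this)
  refine ⟨v, fun x => ?_⟩
  obtain ⟨p, hp, rfl⟩ := exists_sphericalCoord_eq x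
  rw [hv ⟨p, hp⟩, hG]
  rfl

/-! ### Circle-valued maps on the torus -/

/-- The universal covering of the torus. -/
noncomputable def torusCover : C(ℝ × ℝ, Circle × Circle) where
  toFun p := (AddCircle.toCircle (p.1 : UnitAddCircle), AddCircle.toCircle (p.2 : UnitAddCircle))

theorem torusCover_eq_iff {p p' : ℝ × ℝ} : torusCover p = torusCover p' ↔
    (p.1 : UnitAddCircle) = p'.1 ∧ (p.2 : UnitAddCircle) = p'.2 := by
  simp only [torusCover, ContinuousMap.coe_mk, Prod.mk.injEq,
    (AddCircle.injective_toCircle (one_ne_zero (α := ℝ))).eq_iff]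

theorem exists_torusCover_eq (x : Circle × Circle) :
    ∃ p ∈ Set.Icc (0 : ℝ) 1 ×ˢ Set.Icc (0 : ℝ) 1, torusCover p = x := by
  have key : ∀ z : Circle, ∃ t ∈ Set.Icc (0 : ℝ) 1, AddCircle.toCircle (t : UnitAddCircle) = z := by
    intro z
    obtain ⟨a, ha⟩ := (AddCircle.homeomorphCircle (one_ne_zero (α := ℝ))).surjective z
    rw [AddCircle.homeomorphCircle_apply] at ha
    obtain ⟨t, ht, rfl⟩ : a ∈ ((↑) : ℝ → UnitAddCircle) '' Set.Icc 0 (0 + 1) := by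
      rw [AddCircle.coe_image_Icc_eq]
      trivial
    exact ⟨t, by simpa using ht, ha⟩
  obtain ⟨s, hs, h1⟩ := key x.1
  obtain ⟨t, ht, h2⟩ := key x.2
  exact ⟨(s, t), ⟨hs, ht⟩, Prod.ext h1 h2⟩

theorem circleRankLE_torus : CircleRankLE (Circle × Circle) 2 := by
  have hex : ∀ g : C(Circle × Circle, UnitAddCircle), ∃ (G : C(ℝ × ℝ, ℝ)) (m n : ℤ),
      (∀ p, (G p : UnitAddCircle) = g (torusCover p)) ∧
      (∀ p, G (p.1 + 1, p.2) - G p = m) ∧ ∀ p, G (p.1, p.2 + 1) - G p = n := by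
    intro g
    obtain ⟨G, hG⟩ := exists_real_lift (g.comp torusCover)
    have h1 : ∀ p, ((G (p.1 + 1, p.2) - G p : ℝ) : UnitAddCircle) = 0 := by
      intro p
      have : torusCover (p.1 + 1, p.2) = torusCover p := by simp [torusCover_eq_iff]
      rw [AddCircle.coe_sub, hG, hG, ContinuousMap.comp_apply, ContinuousMap.comp_apply, this, sub_self]
    have h2 : ∀ p, ((G (p.1, p.2 + 1) - G p : ℝ) : UnitAddCircle) = 0 := by
      intro p
      have : torusCover (p.1, p.2 + 1) = torusCover p := by simp [torusCover_eq_iff]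
      rw [AddCircle.coe_sub, hG, hG, ContinuousMap.comp_apply, ContinuousMap.comp_apply, this, sub_self]
    obtain ⟨m, hm⟩ := exists_int_of_coe_eq_zero (h1 (0, 0))
    obtain ⟨n, hn⟩ := exists_int_of_coe_eq_zero (h2 (0, 0))
    refine ⟨G, m, n, hG, fun p => ?_, fun p => ?_⟩
    · rw [← hm]
      exact eq_of_coe_eq_zero (by fun_prop) h1 p (0, 0)
    · rw [← hn]
      exact eq_of_coe_eq_zero (by fun_prop) h2 p (0, 0)
  choose G m n hG hm hn using hex
  -- Lifts are chosen arbitrarily, but the lift of a sum and the sum of the lifts differ by a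
  -- constant, so the periods `m` and `n` are additive.
  have hadd : ∀ g g' p p', G (g + g') p - G g p - G g' p = G (g + g') p' - G g p' - G g' p' := by
    intro g g'
    refine eq_of_coe_eq_zero (by fun_prop) fun p => ?_
    simp [hG]
  refine ⟨AddMonoidHom.mk' (fun g => ![m g, n g]) ?_, ?_⟩
  · intro g g'
    have h1 : m (g + g') = m g + m g' := by
      have := hadd g g' (0 + 1, 0) (0, 0)
      have h1 := hm (g + g') (0, 0)
      have h2 := hm g (0, 0)
      have h3 := hm g' (0, 0)
      have : (m (g + g') : ℝ) = m g + m g' := by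
        simp only at *
        linarith
      exact_mod_cast this
    have h2 : n (g + g') = n g + n g' := by
      have := hadd g g' (0, 0 + 1) (0, 0)
      have h1 := hn (g + g') (0, 0)
      have h2 := hn g (0, 0)
      have h3 := hn g' (0, 0)
      have : (n (g + g') : ℝ) = n g + n g' := by
        simp only at *
        linarith
      exact_mod_cast this
    simp [h1, h2]
  · intro g hg
    have hm0 : m g = 0 := congrFun hg 0
    have hn0 : n g = 0 := congrFun hg 1
    have hx : ∀ y, Function.Periodic (fun x => G g (x, y)) 1 := fun y x =>
      sub_eq_zero.1 ((hm g (x, y)).trans (by simp [hm0]))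
    have hy : ∀ x, Function.Periodic (fun y => G g (x, y)) 1 := fun x y =>
      sub_eq_zero.1 ((hn g (x, y)).trans (by simp [hn0]))
    have : CompactSpace (Set.Icc (0 : ℝ) 1 ×ˢ Set.Icc (0 : ℝ) 1 : Set (ℝ × ℝ)) :=
      isCompact_iff_compactSpace.1 (isCompact_Icc.prod isCompact_Icc)
    obtain ⟨v, hv⟩ := exists_continuousMap_comp_eq
      (Y := (Set.Icc (0 : ℝ) 1 ×ˢ Set.Icc (0 : ℝ) 1 : Set (ℝ × ℝ)))
      (P := fun p => torusCover p) (by fun_prop)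
      (fun x => by
        obtain ⟨p, hp, h⟩ := exists_torusCover_eq x
        exact ⟨⟨p, hp⟩, h⟩) (u := fun p => G g p) (by fun_prop) (by
        rintro ⟨⟨x, y⟩, _⟩ ⟨⟨x', y'⟩, _⟩ h
        obtain ⟨h1, h2⟩ := torusCover_eq_iff.1 h
        simp only at h1 h2
        rw [← sub_eq_zero, ← AddCircle.coe_sub] at h1 h2
        obtain ⟨i, hi⟩ := exists_int_of_coe_eq_zero h1
        obtain ⟨j, hj⟩ := exists_int_of_coe_eq_zero h2
        obtain rfl : x = x' + i * 1 := by linarith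
        obtain rfl : y = y' + j * 1 := by linarith
        exact ((hx (y' + j * 1)).int_mul i x').trans ((hy x').int_mul j y'))
    refine ⟨v, fun x => ?_⟩
    obtain ⟨p, hp, rfl⟩ := exists_torusCover_eq x
    rw [hv ⟨p, hp⟩, hG]

end CircleValued

/-! ## Integral cocycles of a cellular embedding -/

section Polygon

theorem exp_two_pi_eq_of_sub_eq_int {x y : ℝ} {n : ℤ} (h : x - y = n) :
    Complex.exp (2 * Real.pi * Complex.I * x) = Complex.exp (2 * Real.pi * Complex.I * y) := by
  rw [Complex.exp_eq_exp_iff_exists_int]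
  refine ⟨n, ?_⟩
  obtain rfl : x = y + n := by linarith
  push_cast
  ring

theorem exists_eq_exp_two_pi {z : ℂ} (hz : z ∈ Metric.sphere (0 : ℂ) 1) {n : ℕ} (hn : n ≠ 0) :
    ∃ (k : Fin n) (t : unitInterval),
      z = Complex.exp (2 * Real.pi * Complex.I * ((k : ℕ) + (t : ℝ)) / n) := by
  have hn' : (0 : ℝ) < n := by exact_mod_cast Nat.pos_of_ne_zero hn
  set x := z.arg / (2 * Real.pi) with hx
  set s := Int.fract x with hs
  have hs0 : 0 ≤ s := Int.fract_nonneg _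
  have hs1 : s < 1 := Int.fract_lt_one _
  have hz1 : z = Complex.exp (2 * Real.pi * Complex.I * s) := by
    rw [exp_two_pi_eq_of_sub_eq_int (y := x) (n := -⌊x⌋) (by rw [hs, Int.fract]; push_cast; ring)]
    have h1 := Complex.norm_mul_exp_arg_mul_I z
    rw [mem_sphere_zero_iff_norm.1 hz, Complex.ofReal_one, one_mul] at h1
    have h2 : (2 * Real.pi * Complex.I * x : ℂ) = z.arg * Complex.I := by
      rw [hx]
      push_cast
      field_simp
    rw [h2, h1]
  have hlt : ⌊s * n⌋₊ < n := by
    rw [Nat.floor_lt (by positivity)]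
    nlinarith
  refine ⟨⟨⌊s * n⌋₊, hlt⟩, ⟨s * n - ⌊s * n⌋₊, ?_, ?_⟩, ?_⟩
  · have := Nat.floor_le (a := s * n) (by positivity)
    linarith
  · have := Nat.lt_floor_add_one (s * n)
    linarith
  · rw [hz1]
    congr 1
    have : (n : ℂ) ≠ 0 := by exact_mod_cast hn
    push_cast
    field_simp
    ring

/-- A function on the boundary of the `n`-gon whose slopes on the sides add up to zero, extended
to the plane. -/
theorem exists_continuousMap_polygon {n : ℕ} (hn : n ≠ 0) (f : Fin n → ℤ) (hf : ∑ k, f k = 0) :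
    ∃ U : C(ℂ, ℝ), ∀ (k : Fin n) (t : unitInterval),
      (U (Complex.exp (2 * Real.pi * Complex.I * ((k : ℕ) + (t : ℝ)) / n)) : UnitAddCircle) =
        ((f k * t : ℝ) : UnitAddCircle) := by
  have hn' : (0 : ℝ) < n := by exact_mod_cast Nat.pos_of_ne_zero hn
  -- Piecewise linear, rising by `f j` along side `j`; its value at each corner is an integer, and
  -- `∑ f = 0` makes it close up.
  let b : ℝ → ℝ := fun s => ∑ j, f j * max 0 (min 1 (n * s - (j : ℕ)))
  have hbc : Continuous b := by fun_prop
  have hbk : ∀ (k : Fin n) (t : unitInterval), b (((k : ℕ) + (t : ℝ)) / n) =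
      ((∑ j ∈ Finset.univ.filter (· < k), f j : ℤ) : ℝ) + f k * t := by
    intro k t
    have ht0 := t.2.1
    have ht1 := t.2.2
    have hterm : ∀ j : Fin n, (f j : ℝ) * max 0 (min 1 (n * (((k : ℕ) + (t : ℝ)) / n) - (j : ℕ))) =
        (if j < k then (f j : ℝ) else 0) + if j = k then (f k : ℝ) * t else 0 := by
      intro j
      rw [mul_div_cancel₀ _ hn'.ne']
      rcases lt_trichotomy j k with h | h | h
      · have : ((j : ℕ) : ℝ) + 1 ≤ (k : ℕ) := by exact_mod_cast h
        rw [if_pos h, if_neg h.ne, min_eq_left (by linarith), max_eq_right zero_le_one]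
        ring
      · subst h
        rw [if_neg (lt_irrefl _), if_pos rfl, min_eq_right (by linarith), max_eq_right (by linarith)]
        ring
      · have : ((k : ℕ) : ℝ) + 1 ≤ (j : ℕ) := by exact_mod_cast h
        rw [if_neg h.not_gt, if_neg h.ne', max_eq_left]
        · ring
        · exact (min_le_right _ _).trans (by linarith)
    simp only [b, hterm, Finset.sum_add_distrib, Finset.sum_ite_eq', Finset.mem_univ, if_true]
    rw [← Finset.sum_filter]
    push_cast
    rfl
  have hb0 : b 0 = 0 := by
    refine Finset.sum_eq_zero fun j _ => ?_
    rw [max_eq_left, mul_zero]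
    exact (min_le_right _ _).trans (by simp)
  have hb1 : b 1 = 0 := by
    have : b 1 = ((∑ j, f j : ℤ) : ℝ) := by
      push_cast
      refine Finset.sum_congr rfl fun j _ => ?_
      have : ((j : ℕ) : ℝ) + 1 ≤ n := by exact_mod_cast j.2
      rw [min_eq_left (by linarith), max_eq_right zero_le_one, mul_one]
    rw [this, hf, Int.cast_zero]
  let β : C(UnitAddCircle, ℝ) :=
    ⟨AddCircle.liftIco 1 0 b, AddCircle.liftIco_zero_continuous (hb0.trans hb1.symm) hbc.continuousOn⟩
  have hβ : ∀ s ∈ Set.Icc (0 : ℝ) 1, AddCircle.liftIco 1 0 b (s : UnitAddCircle) = b s := by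
    rintro s ⟨hs0, hs1⟩
    rcases hs1.lt_or_eq with h | rfl
    · exact AddCircle.liftIco_zero_coe_apply ⟨hs0, h⟩
    · have h1 : ((1 : ℝ) : UnitAddCircle) = ((0 : ℝ) : UnitAddCircle) := by simp
      rw [h1, hb1]
      refine Eq.trans ?_ hb0
      exact AddCircle.liftIco_zero_coe_apply ⟨le_rfl, zero_lt_one⟩
  have he : Topology.IsClosedEmbedding (fun x : UnitAddCircle => (AddCircle.toCircle x : ℂ)) :=
    Continuous.isClosedEmbedding (by fun_prop)
      (Subtype.val_injective.comp (AddCircle.injective_toCircle one_ne_zero))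
  -- Tietze extension from the unit circle to the plane.
  obtain ⟨U, hU⟩ := ContinuousMap.exists_extension he β
  refine ⟨U, fun k t => ?_⟩
  set s : ℝ := ((k : ℕ) + (t : ℝ)) / n with hs
  have hsI : s ∈ Set.Icc (0 : ℝ) 1 := by
    have ht0 := t.2.1
    have ht1 := t.2.2
    have : ((k : ℕ) : ℝ) + 1 ≤ n := by exact_mod_cast k.2
    constructor
    · positivity
    · rw [hs, div_le_one hn']
      linarith
  have h1 : Complex.exp (2 * Real.pi * Complex.I * ((k : ℕ) + (t : ℝ)) / n) =
      (AddCircle.toCircle (s : UnitAddCircle) : ℂ) := by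
    rw [AddCircle.toCircle_apply_mk, Circle.coe_exp, hs]
    congr 1
    push_cast
    ring
  have h2 : U (AddCircle.toCircle (s : UnitAddCircle) : ℂ) = AddCircle.liftIco 1 0 b (s : UnitAddCircle) :=
    DFunLike.congr_fun hU (s : UnitAddCircle)
  rw [h1, h2, hβ s hsI, hs, hbk, AddCircle.coe_add, coe_int_eq_zero, zero_add]

end Polygon

namespace CellularEmbedding

variable {V : Type u} {G : SimpleGraph V} {S : Type} [TopologicalSpace S]
  (φ : CellularEmbedding G S)

theorem arc_one (d : G.Dart) : φ.arc d 1 = φ.vertex d.snd := by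
  have h1 := φ.arc_symm d 0
  rw [unitInterval.symm_zero, φ.arc_zero] at h1
  exact h1.symm

/-- A map to `ℝ/ℤ` is defined on the support of the graph by an antisymmetric integral function. -/
theorem support_value_unique {f : G.Dart → ℤ} (hf : ∀ d, f d.symm = -f d) {x : S}
    {w w' : UnitAddCircle}
    (h : (∃ d t, x = φ.arc d t ∧ w = ((f d * t : ℝ) : UnitAddCircle)) ∨ ∃ v, x = φ.vertex v ∧ w = 0)
    (h' : (∃ d t, x = φ.arc d t ∧ w' = ((f d * t : ℝ) : UnitAddCircle)) ∨
      ∃ v, x = φ.vertex v ∧ w' = 0) : w = w' := by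
  have hend : ∀ (d : G.Dart) (t : unitInterval), t = 0 ∨ t = 1 →
      ((f d * t : ℝ) : UnitAddCircle) = 0 := by
    rintro d t (rfl | rfl)
    · simp
    · simp [coe_int_eq_zero]
  have hav : ∀ (d : G.Dart) t v, φ.arc d t = φ.vertex v → ((f d * t : ℝ) : UnitAddCircle) = 0 :=
    fun d t v h => hend d t (φ.arc_vertex d t v h)
  rcases h with ⟨d, t, rfl, rfl⟩ | ⟨v, rfl, rfl⟩ <;> rcases h' with ⟨e, s, hx, rfl⟩ | ⟨v', hx, rfl⟩
  · by_cases hde : d.edge = e.edge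
    · rcases SimpleGraph.dart_edge_eq_iff d e |>.1 hde with rfl | rfl
      · rw [φ.arc_injective d hx]
      · rw [φ.arc_symm] at hx
        have := φ.arc_injective e hx
        rw [← this, hf, ← sub_eq_zero, ← AddCircle.coe_sub, unitInterval.coe_symm_eq]
        convert coe_int_eq_zero (-f e) using 2
        push_cast
        ring
    · obtain ⟨ht, hs⟩ := φ.arc_arc d e t s hde hx
      rw [hend d t ht, hend e s hs]
  · exact hav _ _ _ hx
  · exact (hav _ _ _ hx.symm).symm
  · rfl

/-- An integral cocycle is realized by a map to `ℝ/ℤ`. -/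
theorem exists_circleMap [T2Space S] [Finite V] {f : G.Dart → ℤ} (hf : ∀ d, f d.symm = -f d)
    (hsum : ∀ i, ∑ k, f (φ.side ⟨i, k⟩) = 0) :
    ∃ g : C(S, UnitAddCircle), ∀ d t, g (φ.arc d t) = ((f d * t : ℝ) : UnitAddCircle) := by
  have hU : ∀ i, ∃ U : C(ℂ, ℝ), (φ.len i = 0 → U = 0) ∧
      ∀ (k : Fin (φ.len i)) (t : unitInterval),
        (U (Complex.exp (2 * Real.pi * Complex.I * ((k : ℕ) + (t : ℝ)) / φ.len i)) : UnitAddCircle) =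
          ((f (φ.side ⟨i, k⟩) * t : ℝ) : UnitAddCircle) := by
    intro i
    by_cases h : φ.len i = 0
    · exact ⟨0, fun _ => rfl, fun k => absurd k.2 (by omega)⟩
    · obtain ⟨U, hU⟩ := exists_continuousMap_polygon h _ (hsum i)
      exact ⟨U, fun h' => absurd h' h, hU⟩
  choose U hU0 hU using hU
  -- The value prescribed on the graph, as a relation: a point may lie on several arcs, and
  -- `support_value_unique` makes the value single.
  let R : S → UnitAddCircle → Prop := fun x w =>
    (∃ d t, x = φ.arc d t ∧ w = ((f d * t : ℝ) : UnitAddCircle)) ∨ ∃ v, x = φ.vertex v ∧ w = 0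
  have hRsupp : ∀ x w, R x w → x ∈ φ.support := by
    rintro x w (⟨d, t, rfl, -⟩ | ⟨v, rfl, -⟩)
    · exact Or.inr (Set.mem_iUnion.2 ⟨d, t, rfl⟩)
    · exact Or.inl ⟨v, rfl⟩
  have hint : ∀ i, ∀ z ∈ Metric.ball (0 : ℂ) 1, φ.cell i z ∉ φ.support := by
    intro i z hz
    rw [← Set.mem_compl_iff, ← φ.cell_cover]
    exact Set.mem_iUnion.2 ⟨i, z, hz, rfl⟩
  have hbd : ∀ i, ∀ z ∈ Metric.sphere (0 : ℂ) 1, R (φ.cell i z) (U i z : UnitAddCircle) := by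
    intro i z hz
    by_cases h : φ.len i = 0
    · obtain ⟨v, hv⟩ := φ.cell_boundary_of_len_eq_zero i h
      exact Or.inr ⟨v, hv z hz, by simp [hU0 i h]⟩
    · obtain ⟨k, t, rfl⟩ := exists_eq_exp_two_pi hz h
      exact Or.inl ⟨_, t, φ.cell_side i k t, hU i k t⟩
  let _ : TopologicalSpace V := ⊥
  have : DiscreteTopology V := ⟨rfl⟩
  have := φ.face_finite
  have : CompactSpace (Metric.closedBall (0 : ℂ) 1) :=
    isCompact_iff_compactSpace.1 (isCompact_closedBall 0 1)
  -- The surface is a quotient of the compact disjoint union of closed discs and vertices; the map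
  -- to `ℝ/ℤ` is built upstairs and descends.
  let P : (Σ _ : φ.Face, Metric.closedBall (0 : ℂ) 1) ⊕ V → S :=
    Sum.elim (fun p => φ.cell p.1 p.2) φ.vertex
  let u : (Σ _ : φ.Face, Metric.closedBall (0 : ℂ) 1) ⊕ V → UnitAddCircle :=
    Sum.elim (fun p => (U p.1 p.2 : UnitAddCircle)) fun _ => 0
  have hP : Continuous P := by
    refine Continuous.sumElim ?_ continuous_of_discreteTopology
    exact continuous_sigma fun i => (φ.cell_continuousOn i).domRestrict
  have hu : Continuous u := by
    refine Continuous.sumElim ?_ continuous_const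
    refine continuous_sigma fun i => ?_
    exact (AddCircle.continuous_mk' 1).comp ((U i).continuous.comp continuous_subtype_val)
  have hcase : ∀ y, (∃ i, ∃ z ∈ Metric.ball (0 : ℂ) 1, P y = φ.cell i z ∧
      u y = (U i z : UnitAddCircle)) ∨ R (P y) (u y) := by
    rintro (⟨i, z, hz⟩ | v)
    · rcases (Metric.mem_closedBall.1 hz).lt_or_eq with h | h
      · exact Or.inl ⟨i, z, h, rfl, rfl⟩
      · exact Or.inr (hbd i z h)
    · exact Or.inr (Or.inr ⟨v, rfl, rfl⟩)
  have hsurj : Function.Surjective P := by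
    intro x
    by_cases hx : x ∈ φ.support
    · rcases hx with ⟨v, rfl⟩ | hx
      · exact ⟨Sum.inr v, rfl⟩
      · obtain ⟨d, t, rfl⟩ := Set.mem_iUnion.1 hx
        obtain ⟨⟨i, k⟩, rfl⟩ := φ.side.surjective d
        refine ⟨Sum.inl ⟨i, _, ?_⟩, φ.cell_side i k t⟩
        rw [mem_closedBall_zero_iff, Complex.norm_exp]
        have : (2 * Real.pi * Complex.I * ((k : ℕ) + (t : ℝ)) / φ.len i).re = 0 := by
          have : (2 * Real.pi * Complex.I * ((k : ℕ) + (t : ℝ)) / φ.len i) =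
              ((2 * Real.pi * ((k : ℕ) + (t : ℝ)) / φ.len i : ℝ) : ℂ) * Complex.I := by
            push_cast
            ring
          rw [this, Complex.re_ofReal_mul, Complex.I_re, mul_zero]
        rw [this, Real.exp_zero]
    · rw [← Set.mem_compl_iff, ← φ.cell_cover] at hx
      obtain ⟨i, z, hz, rfl⟩ := Set.mem_iUnion.1 hx
      exact ⟨Sum.inl ⟨i, z, Metric.ball_subset_closedBall hz⟩, rfl⟩
  obtain ⟨g, hg⟩ := exists_continuousMap_comp_eq hP hsurj hu (by
    intro x y hxy
    rcases hcase x with ⟨i, z, hz, hx, hux⟩ | hx <;> rcases hcase y with ⟨j, w, hw, hy, huy⟩ | hy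
    · have hij : i = j := by
        by_contra hij
        exact Set.disjoint_left.1 (φ.cell_disjoint i j hij) ⟨z, hz, rfl⟩
          ⟨w, hw, by rw [← hx, hxy, hy]⟩
      subst hij
      rw [hux, huy, φ.cell_injOn i hz hw (by rw [← hx, hxy, hy])]
    · exact absurd (hRsupp _ _ hy) (by rw [← hxy, hx]; exact hint i z hz)
    · exact absurd (hRsupp _ _ hx) (by rw [hxy, hy]; exact hint j w hw)
    · rw [hxy] at hx
      exact φ.support_value_unique hf hx hy)
  refine ⟨g, fun d t => ?_⟩
  obtain ⟨y, hy⟩ := hsurj (φ.arc d t)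
  rcases hcase y with ⟨i, z, hz, h, -⟩ | h
  · have hmem : φ.arc d t ∈ φ.support := Or.inr (Set.mem_iUnion.2 ⟨d, t, rfl⟩)
    rw [← hy, h] at hmem
    exact absurd hmem (hint i z hz)
  · rw [← hy, hg]
    exact φ.support_value_unique hf h (Or.inl ⟨d, t, hy, rfl⟩)

/-- If the map realizing an integral cocycle lifts to `ℝ`, the cocycle is a coboundary. -/
theorem exists_eq_sub_of_lift {f : G.Dart → ℤ} {g : C(S, UnitAddCircle)} {Γ : C(S, ℝ)}
    (hΓ : ∀ x, (Γ x : UnitAddCircle) = g x) {d : G.Dart}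
    (hg : ∀ t, g (φ.arc d t) = ((f d * t : ℝ) : UnitAddCircle)) :
    f d = ⌊Γ (φ.vertex d.snd)⌋ - ⌊Γ (φ.vertex d.fst)⌋ := by
  have h := eq_of_coe_eq_zero (D := fun t : unitInterval => Γ (φ.arc d t) - f d * t) (by fun_prop)
    (fun t => by rw [AddCircle.coe_sub, hΓ, hg, sub_self]) 1 0
  simp only [arc_one, φ.arc_zero, Set.Icc.coe_zero, Set.Icc.coe_one, mul_one, mul_zero,
    sub_zero] at h
  have h2 : Γ (φ.vertex d.snd) = Γ (φ.vertex d.fst) + f d := by linarith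
  -- The ends differ by the integer `f d`, so floors turn the real potential into an integral one
  -- with the same differences.
  rw [h2, Int.floor_add_intCast]
  ring

/-- The walk around a face is closed. -/
theorem sum_side_snd_eq_sum_side_fst (i : φ.Face) {M : Type*} [AddCommMonoid M] (c : V → M) :
    ∑ k, c (φ.side ⟨i, k⟩).snd = ∑ k, c (φ.side ⟨i, k⟩).fst := by
  rcases Nat.eq_zero_or_pos (φ.len i) with h0 | hpos
  · have : IsEmpty (Fin (φ.len i)) := by rw [h0]; infer_instance
    simp
  have : NeZero (φ.len i) := ⟨hpos.ne'⟩
  rw [← Equiv.sum_comp (Equiv.addRight (1 : Fin (φ.len i))) fun k => c (φ.side ⟨i, k⟩).fst]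
  refine Finset.sum_congr rfl fun k _ => congrArg c (φ.vertex_injective ?_)
  rw [← arc_one, ← φ.arc_zero, ← φ.cell_side, ← φ.cell_side]
  congr 1
  have hn' : (φ.len i : ℝ) ≠ 0 := by exact_mod_cast hpos.ne'
  -- The end of side `k` and the start of the cyclically next side have parameters differing by an
  -- integer, nonzero only at the wrap-around; hence they are the same boundary point.
  have key : ((k : ℕ) + 1 : ℝ) / φ.len i - ((Equiv.addRight (1 : Fin (φ.len i)) k : ℕ) : ℝ) / φ.len i =
      (((k : ℕ) + 1) / φ.len i : ℕ) := by
    have h1 : (Equiv.addRight (1 : Fin (φ.len i)) k : ℕ) = ((k : ℕ) + 1) % φ.len i := by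
      rw [Equiv.coe_addRight, Fin.val_add, Fin.val_one', Nat.add_mod_mod]
    have h2 := Nat.div_add_mod ((k : ℕ) + 1) (φ.len i)
    rw [h1]
    have h3 : (φ.len i : ℝ) * (((k : ℕ) + 1) / φ.len i : ℕ) + (((k : ℕ) + 1) % φ.len i : ℕ) =
        (k : ℕ) + 1 := by exact_mod_cast h2
    field_simp
    linarith
  have := exp_two_pi_eq_of_sub_eq_int (n := (((k : ℕ) + 1) / φ.len i : ℕ))
    (x := ((k : ℕ) + 1 : ℝ) / φ.len i) (by rw [key]; norm_cast)
  refine Eq.trans ?_ (this.trans ?_) <;> congr 1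
  · simp
    ring
  · simp
    ring

end CellularEmbedding

/-! ## The Euler inequality -/

/-- Vertices outside the range of `ι` are isolated, so every cycle of the image pulls back. -/
theorem SimpleGraph.egirth_le_egirth_map {V W : Type*} (G : SimpleGraph V) (ι : V ↪ W) :
    G.egirth ≤ (G.map ι).egirth := by
  rw [SimpleGraph.le_egirth]
  intro a w hw
  have hs : ∀ x ∈ w.support, x ∈ Set.range ι := by
    intro x hx
    obtain ⟨y, hy⟩ : ∃ y, (G.map ι).Adj x y := by
      obtain ⟨e, he, hxe⟩ := (SimpleGraph.Walk.mem_support_iff_exists_mem_edges_of_not_nil hw.not_nil).1 hx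
      obtain ⟨y, rfl⟩ := Sym2.mem_iff_exists.1 hxe
      exact ⟨y, w.edges_subset_edgeSet he⟩
    obtain ⟨-, u, v, -, rfl, -⟩ := hy
    exact ⟨u, rfl⟩
  let f : (G.map ι).induce (Set.range ι) →g G :=
    { toFun := fun x => x.2.choose
      map_rel' := by
        rintro x y hxy
        obtain ⟨-, u, v, huv, hu, hv⟩ := hxy
        have hx := x.2.choose_spec
        have hy := y.2.choose_spec
        have h1 : x.2.choose = u := ι.injective (hx.trans hu.symm)
        have h2 : y.2.choose = v := ι.injective (hy.trans hv.symm)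
        rwa [h1, h2] }
  have hf : Function.Injective f := by
    intro x y hxy
    have hx := x.2.choose_spec
    have hy := y.2.choose_spec
    exact Subtype.ext (hx.symm.trans ((congrArg ι hxy).trans hy))
  have h1 : (w.induce _ hs).IsCycle := by
    refine SimpleGraph.Walk.IsCycle.of_map (f := (SimpleGraph.Embedding.induce _).toHom) ?_
    rw [SimpleGraph.Walk.map_induce]
    exact hw
  have h2 := SimpleGraph.egirth_le_length (h1.map hf)
  have h3 : (w.induce _ hs).length = w.length := by
    rw [← SimpleGraph.Walk.length_map (SimpleGraph.Embedding.induce _).toHom,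
      SimpleGraph.Walk.map_induce]
    rfl
  rwa [SimpleGraph.Walk.length_map, h3] at h2

/-! ### Edges and their two orientations -/

section PosDart

variable {V : Type u} [LinearOrder V] {G : SimpleGraph V}

/-- The edges, oriented from the smaller to the larger end. -/
abbrev PosDart (G : SimpleGraph V) : Type u := {d : G.Dart // d.fst < d.snd}

theorem PosDart.not_symm_lt (e : PosDart G) : ¬ e.1.symm.fst < e.1.symm.snd := not_lt.2 e.2.le

theorem symm_lt_of_not_lt {d : G.Dart} (h : ¬ d.fst < d.snd) : d.symm.fst < d.symm.snd :=
  lt_of_le_of_ne (not_lt.1 h) d.adj.ne.symm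

theorem sum_darts [Fintype G.Dart] [Fintype (PosDart G)] {M : Type*} [AddCommMonoid M]
    (F : G.Dart → M) : ∑ d, F d = ∑ e : PosDart G, (F e.1 + F e.1.symm) := by
  classical
  rw [Finset.sum_add_distrib, ← Finset.sum_filter_add_sum_filter_not Finset.univ
    (fun d : G.Dart => d.fst < d.snd) F]
  congr 1
  · exact Finset.sum_bij' (fun d hd => ⟨d, (Finset.mem_filter.1 hd).2⟩) (fun e _ => e.1)
      (by simp) (fun e _ => by simp [e.2]) (by simp) (by simp) (by simp)
  · exact Finset.sum_bij' (fun d hd => ⟨d.symm, symm_lt_of_not_lt (Finset.mem_filter.1 hd).2⟩)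
      (fun e _ => e.1.symm) (by simp)
      (fun e _ => Finset.mem_filter.2 ⟨Finset.mem_univ _, e.not_symm_lt⟩) (by simp) (by simp) (by simp)

/-- Antisymmetric extension of a function on the edges to the darts. -/
def antiExtend {M : Type*} [Neg M] (x : PosDart G → M) (d : G.Dart) : M :=
  if h : d.fst < d.snd then x ⟨d, h⟩ else -x ⟨d.symm, symm_lt_of_not_lt h⟩

theorem antiExtend_pos {M : Type*} [Neg M] (x : PosDart G → M) (e : PosDart G) :
    antiExtend x e.1 = x e := dif_pos e.2

theorem antiExtend_neg {M : Type*} [Neg M] (x : PosDart G → M) (e : PosDart G) :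
    antiExtend x e.1.symm = -x e := by
  simp [antiExtend, e.2.le]

theorem antiExtend_symm {M : Type*} [InvolutiveNeg M] (x : PosDart G → M) (d : G.Dart) :
    antiExtend x d.symm = -antiExtend x d := by
  by_cases h : d.fst < d.snd
  · exact (antiExtend_neg x ⟨d, h⟩).trans (by rw [antiExtend_pos x ⟨d, h⟩])
  · have h2 := antiExtend_neg x ⟨d.symm, symm_lt_of_not_lt h⟩
    rw [SimpleGraph.Dart.symm_symm] at h2
    rw [h2, neg_neg]
    exact antiExtend_pos x ⟨d.symm, symm_lt_of_not_lt h⟩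

end PosDart

/-! ### Rank of cocycles modulo coboundaries -/

namespace CellularEmbedding

variable {V : Type u} {G : SimpleGraph V} {S : Type} [TopologicalSpace S]
  (φ : CellularEmbedding G S)

/-- The face on the left of a dart. -/
def face (d : G.Dart) : φ.Face := (φ.side.symm d).1

theorem finite_dart {V : Type u} {G : SimpleGraph V} {S : Type} [TopologicalSpace S]
    (φ : CellularEmbedding G S) : Finite G.Dart :=
  have := φ.face_finite
  Finite.of_equiv _ φ.side

open Classical in
theorem sum_side [Fintype G.Dart] {M : Type*} [AddCommMonoid M] (F : G.Dart → M) (i : φ.Face) :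
    ∑ k, F (φ.side ⟨i, k⟩) = ∑ d, if φ.face d = i then F d else 0 := by
  have := φ.face_finite
  have := Fintype.ofFinite φ.Face
  rw [← Equiv.sum_comp φ.side, Fintype.sum_sigma, Finset.sum_eq_single i]
  · simp [face]
  · intro j _ hj
    simp [face, hj]
  · simp

variable [LinearOrder V] [Fintype (PosDart G)]

theorem sum_side_antiExtend (x : PosDart G → ℤ) (i : φ.Face) :
    ((∑ k, antiExtend x (φ.side ⟨i, k⟩) : ℤ) : ℚ) =
      sumMap (fun e => φ.face e.1) (fun e => φ.face e.1.symm) (fun e => (x e : ℚ)) i := by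
  classical
  have := φ.finite_dart
  have := Fintype.ofFinite G.Dart
  rw [φ.sum_side, sum_darts, sumMap_apply]
  push_cast
  refine Finset.sum_congr rfl fun e _ => ?_
  rw [antiExtend_pos, antiExtend_neg]
  by_cases h1 : φ.face e.1 = i <;> by_cases h2 : φ.face e.1.symm = i <;> simp [h1, h2]

/-- The boundary of a boundary vanishes: grouping the darts by face leaves sums over closed walks.
-/
theorem sumMap_diffMap (w : φ.Face → ℚ) :
    sumMap (fun e : PosDart G => e.1.snd) (fun e => e.1.fst)
      (diffMap (fun e => φ.face e.1) (fun e => φ.face e.1.symm) w) = 0 := by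
  classical
  have := φ.face_finite
  have := Fintype.ofFinite φ.Face
  have := φ.finite_dart
  have := Fintype.ofFinite G.Dart
  ext v
  let c : V → ℚ := fun x => if x = v then 1 else 0
  have h1 : sumMap (fun e : PosDart G => e.1.snd) (fun e => e.1.fst)
      (diffMap (fun e => φ.face e.1) (fun e => φ.face e.1.symm) w) v =
      ∑ d : G.Dart, w (φ.face d) * (c d.snd - c d.fst) := by
    rw [sum_darts, sumMap_apply]
    refine Finset.sum_congr rfl fun e _ => ?_
    simp only [diffMap_apply, c, SimpleGraph.Dart.symm_toProd, Prod.fst_swap, Prod.snd_swap]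
    ring_nf
  rw [h1, ← Equiv.sum_comp φ.side, Fintype.sum_sigma]
  refine Finset.sum_eq_zero fun i _ => ?_
  have h2 : ∀ k, φ.face (φ.side ⟨i, k⟩) = i := fun k => by simp [face]
  simp only [h2]
  rw [← Finset.mul_sum, Finset.sum_sub_distrib, φ.sum_side_snd_eq_sum_side_fst, sub_self, mul_zero]

/-- A rational cocycle becomes integral after scaling, is realized by a circle-valued map, and is a
coboundary when the invariant `W` of that map vanishes. As `W` takes values in `ℤ^h`, at most `h`
dimensions are lost. -/
theorem finrank_ker_sumMap_face_le [T2Space S] [Fintype V] {h : ℕ} (hS : CircleRankLE S h) :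
    Module.finrank ℚ (LinearMap.ker (sumMap (fun e : PosDart G => φ.face e.1)
        fun e => φ.face e.1.symm)) ≤
      Module.finrank ℚ (LinearMap.range (diffMap (fun e : PosDart G => e.1.snd) fun e => e.1.fst)) + h := by
  classical
  obtain ⟨W, hW⟩ := hS
  -- A relation between cocycles and their invariants, with common denominator `N`. Using a relation
  -- avoids showing that the invariant depends only on the cocycle and not on the realizing map.
  let R : Submodule ℚ ((PosDart G → ℚ) × (Fin h → ℚ)) :=
    { carrier := {p | ∃ (N : ℤ) (f : PosDart G → ℤ) (g : C(S, UnitAddCircle)), N ≠ 0 ∧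
        (∀ e t, g (φ.arc e.1 t) = ((f e * t : ℝ) : UnitAddCircle)) ∧
        (∀ e, N * p.1 e = f e) ∧ ∀ j, N * p.2 j = W g j}
      zero_mem' := ⟨1, 0, 0, one_ne_zero, by simp, by simp, by simp⟩
      add_mem' := by
        rintro p p' ⟨N, f, g, hN, h1, h2, h3⟩ ⟨N', f', g', hN', h1', h2', h3'⟩
        refine ⟨N * N', N' • f + N • f', N' • g + N • g', mul_ne_zero hN hN', ?_, ?_, ?_⟩
        · intro e t
          rw [ContinuousMap.add_apply, ContinuousMap.smul_apply, ContinuousMap.smul_apply, h1, h1',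
            ← AddCircle.coe_zsmul, ← AddCircle.coe_zsmul, ← AddCircle.coe_add]
          congr 1
          simp
          ring
        · intro e
          simp [← h2, ← h2']
          ring
        · intro j
          simp [← h3, ← h3']
          ring
      smul_mem' := by
        rintro c p ⟨N, f, g, hN, h1, h2, h3⟩
        have hc : (c.den : ℚ) * c = c.num := Rat.den_mul_eq_num c
        refine ⟨N * c.den, c.num • f, c.num • g, mul_ne_zero hN (by exact_mod_cast c.den_nz), ?_, ?_, ?_⟩
        · intro e t
          rw [ContinuousMap.smul_apply, h1, ← AddCircle.coe_zsmul]
          congr 1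
          simp
          ring
        · intro e
          push_cast [Prod.smul_fst, Pi.smul_apply, smul_eq_mul]
          rw [← h2, ← hc]
          ring
        · intro j
          simp only [Prod.smul_snd, Pi.smul_apply, smul_eq_mul, map_zsmul]
          push_cast
          rw [← h3, ← hc]
          ring }
  have hker : LinearMap.ker (sumMap (fun e : PosDart G => φ.face e.1) fun e => φ.face e.1.symm) ≤
      R.map (LinearMap.fst ℚ _ _) := by
    intro x hx
    obtain ⟨⟨N, hN⟩, hNx⟩ := IsLocalization.exist_integer_multiples_of_finite (nonZeroDivisors ℤ) x
    choose f hf using hNx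
    have hN0 : N ≠ 0 := nonZeroDivisors.ne_zero hN
    have hf' : ∀ e, (N : ℚ) * x e = f e := fun e => by
      have := hf e
      simpa using this.symm
    have hcoc : ∀ i, ∑ k, antiExtend f (φ.side ⟨i, k⟩) = 0 := by
      intro i
      have h1 := φ.sum_side_antiExtend f i
      have h2 : (fun e => (f e : ℚ)) = (N : ℚ) • x := funext fun e => by simp [← hf']
      rw [h2, map_smul, LinearMap.mem_ker.1 hx, smul_zero, Pi.zero_apply] at h1
      exact_mod_cast h1
    obtain ⟨g, hg⟩ := φ.exists_circleMap (antiExtend_symm f) hcoc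
    refine ⟨(x, fun j => (W g j : ℚ) / N), ⟨N, f, g, hN0, fun e t => ?_, hf', fun j => ?_⟩, rfl⟩
    · rw [hg, antiExtend_pos]
    · have : (N : ℚ) ≠ 0 := by exact_mod_cast hN0
      field_simp
  have h1 := (Submodule.finrank_mono hker).trans (Submodule.finrank_map_le _ R)
  let ψ : R →ₗ[ℚ] (Fin h → ℚ) := (LinearMap.snd ℚ _ _).domRestrict R
  have h2 := LinearMap.finrank_range_add_finrank_ker ψ
  have h3 : Module.finrank ℚ (LinearMap.range ψ) ≤ h := by
    refine (Submodule.finrank_le _).trans ?_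
    simp
  -- With zero invariant the realizing map lifts to `ℝ`, and the floors of the lift at the vertices,
  -- divided by `N`, are a rational potential.
  have h4 : Module.finrank ℚ (LinearMap.ker ψ) ≤ Module.finrank ℚ
      (LinearMap.range (diffMap (fun e : PosDart G => e.1.snd) fun e => e.1.fst)) := by
    refine LinearMap.finrank_le_finrank_of_injective
      (f := LinearMap.codRestrict _ ((LinearMap.fst ℚ _ _).comp
        (R.subtype.comp (LinearMap.ker ψ).subtype)) ?_) ?_
    · rintro ⟨⟨⟨x, w⟩, N, f, g, hN, hg, hf, hw⟩, hψ⟩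
      have hw0 : w = 0 := hψ
      have hWg : W g = 0 := by
        ext j
        have := hw j
        rw [hw0] at this
        simpa using this.symm
      obtain ⟨Γ, hΓ⟩ := hW g hWg
      have hN' : (N : ℚ) ≠ 0 := by exact_mod_cast hN
      refine ⟨fun v => (⌊Γ (φ.vertex v)⌋ : ℚ) / N, funext fun e => ?_⟩
      have h5 := φ.exists_eq_sub_of_lift hΓ (d := e.1) (f := antiExtend f) (fun t => by
        rw [hg, antiExtend_pos])
      rw [antiExtend_pos] at h5
      have h6 := hf e
      rw [h5] at h6
      push_cast at h6
      change (⌊Γ (φ.vertex e.1.snd)⌋ : ℚ) / N - (⌊Γ (φ.vertex e.1.fst)⌋ : ℚ) / N = x e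
      rw [← sub_div, ← h6, mul_div_cancel_left₀ _ hN']
    · intro p p' hpp'
      have h5 : p.1.1.1 = p'.1.1.1 := congrArg Subtype.val hpp'
      have h6 : p.1.1.2 = 0 := p.2
      have h7 : p'.1.1.2 = 0 := p'.2
      exact Subtype.ext (Subtype.ext (Prod.ext h5 (h6.trans h7.symm)))
  omega

end CellularEmbedding

/-- **Euler's inequality** for the subgraph induced by a nonempty set `A` of vertices of a graph `G`
on a surface: there are numbers `m` of edges and `c` of faces with the stated properties. -/
theorem DrawableOn.exists_euler {V : Type u} [Fintype V] {G : SimpleGraph V} [DecidableRel G.Adj]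
    {S : Type} [TopologicalSpace S] [T2Space S] {h : ℕ} (hS : CircleRankLE S h)
    (hG : DrawableOn G S) {g : ℕ} (hg : (g : ℕ∞) ≤ G.egirth) (A : Finset V) (hA : A.Nonempty) :
    ∃ m c : ℕ, ∑ v ∈ A, (A.filter (G.Adj v)).card ≤ 2 * m ∧ m + 1 ≤ A.card + h + (c - 1) ∧
      g * c ≤ 2 * m := by
  classical
  obtain ⟨W, _, H, ⟨φ⟩, ⟨f⟩⟩ := hG
  have := Fintype.ofFinite W
  let _ : LinearOrder W := LinearOrder.lift' _ (Finite.equivFin W).injective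
  have := Fintype.ofFinite (PosDart H)
  have := φ.face_finite
  have := Fintype.ofFinite φ.Face
  let ι : V ↪ W := ⟨f.toHom, f.injective⟩
  let GA : SimpleGraph V :=
    { Adj := fun x y => x ∈ A ∧ y ∈ A ∧ G.Adj x y
      symm := ⟨fun x y hxy => ⟨hxy.2.1, hxy.1, hxy.2.2.symm⟩⟩
      loopless := ⟨fun x hx => hx.2.2.ne rfl⟩ }
  have hGA : GA ≤ G := fun x y hxy => hxy.2.2
  let Γ := GA.map ι
  have hΓA : ∀ x y, Γ.Adj x y → x ∈ A.map ι ∧ y ∈ A.map ι ∧ H.Adj x y := by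
    rintro _ _ ⟨-, x, y, hxy, rfl, rfl⟩
    exact ⟨Finset.mem_map_of_mem _ hxy.1, Finset.mem_map_of_mem _ hxy.2.1, f.toHom.map_adj hxy.2.2⟩
  -- The edges of the ambient graph that come from `G[A]`; further edges of `H` between these
  -- vertices are deleted too.
  let K : Finset (PosDart H) := Finset.univ.filter fun e => Γ.Adj e.1.snd e.1.fst
  have hK : ∀ e ∈ K, Γ.Adj e.1.snd e.1.fst := fun e he => (Finset.mem_filter.1 he).2
  have hgΓ : (g : ℕ∞) ≤ Γ.egirth :=
    hg.trans ((SimpleGraph.egirth_anti hGA).trans (GA.egirth_le_egirth_map ι))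
  have hends : Function.Injective fun e : PosDart H => s(e.1.snd, e.1.fst) := by
    rintro ⟨d, hd⟩ ⟨e, he⟩ hde
    rcases Sym2.eq_iff.1 hde with ⟨h1, h2⟩ | ⟨h1, h2⟩
    · exact Subtype.ext (SimpleGraph.Dart.ext _ _ (Prod.ext h2 h1))
    · simp only at h1 h2
      rw [h1, h2] at hd
      exact absurd hd (not_lt.2 he.le)
  refine ⟨K.card, Nat.card (ProperFace (fun e : PosDart H => φ.face e.1)
    (fun e => φ.face e.1.symm) K), ?_, ?_, ?_⟩
  · rw [← Finset.card_sigma]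
    let p : (Σ _ : V, V) ↪ W × W := ⟨fun x => (ι x.1, ι x.2), by
      rintro ⟨a, b⟩ ⟨a', b'⟩ hab
      simp only [Prod.mk.injEq, ι.injective.eq_iff] at hab
      rw [hab.1, hab.2]⟩
    rw [← Finset.card_map p]
    have hsub : (A.sigma fun v => A.filter (G.Adj v)).map p ⊆
        K.image (fun e => (e.1.fst, e.1.snd)) ∪ K.image fun e => (e.1.snd, e.1.fst) := by
      intro z hz
      obtain ⟨⟨x, y⟩, hxy, rfl⟩ := Finset.mem_map.1 hz
      simp only [Finset.mem_sigma, Finset.mem_filter] at hxy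
      have hadj : Γ.Adj (ι x) (ι y) := SimpleGraph.map_adj_apply.2 hxy
      have hH := (hΓA _ _ hadj).2.2
      rw [Finset.mem_union, Finset.mem_image, Finset.mem_image]
      rcases lt_or_gt_of_ne hadj.ne with hlt | hlt
      · exact Or.inl ⟨⟨⟨(ι x, ι y), hH⟩, hlt⟩, Finset.mem_filter.2 ⟨Finset.mem_univ _, hadj.symm⟩, rfl⟩
      · exact Or.inr ⟨⟨⟨(ι y, ι x), hH.symm⟩, hlt⟩, Finset.mem_filter.2 ⟨Finset.mem_univ _, hadj⟩, rfl⟩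
    refine (Finset.card_le_card hsub).trans ((Finset.card_union_le _ _).trans ?_)
    rw [two_mul]
    exact Nat.add_le_add Finset.card_image_le Finset.card_image_le
  · have := card_add_one_le (φ.finrank_ker_sumMap_face_le hS) φ.sumMap_diffMap K (A.map ι)
      (hA.map) (fun e he => (hΓA _ _ (hK e he)).1) (fun e he => (hΓA _ _ (hK e he)).2.1)
    rwa [Finset.card_map] at this
  · exact mul_card_properFace_le _ _ _ fun c hc =>
      le_card_boundaryEdges φ.sumMap_diffMap hends hK hgΓ c hc

/-- A graph on a surface whose average degrees are controlled by Euler's inequality is degenerate. -/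
theorem DrawableOn.wskErgodic {V : Type u} [Finite V] {G : SimpleGraph V} {S : Type}
    [TopologicalSpace S] [T2Space S] {h : ℕ} (hS : CircleRankLE S h) (hG : DrawableOn G S) {g : ℕ}
    (hg : (g : ℕ∞) ≤ G.egirth) {q : ℕ} (hq : 3 ≤ q) (hh : h ≤ 2)
    (hnum : ∀ n m c : ℕ, q * n ≤ 2 * m → m + 2 ≤ n + h + c → g * c ≤ 2 * m → n = 0) :
    WSKErgodic G q := by
  classical
  have := Fintype.ofFinite V
  refine wskErgodic_of_degenerate (by omega) fun A hA => ?_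
  by_contra! hdeg
  obtain ⟨m, c, h1, h2, h3⟩ := hG.exists_euler hS hg A hA
  have h4 : q * A.card ≤ ∑ v ∈ A, (A.filter (G.Adj v)).card := by
    rw [mul_comm, ← smul_eq_mul, ← Finset.sum_const]
    exact Finset.sum_le_sum hdeg
  obtain ⟨v, hv⟩ := hA
  -- Minimum degree `q` in a simple graph forces `q + 1` vertices. This excludes `c = 0`, where `c -
  -- 1` truncates: then `3n ≤ 2m ≤ 2(n + 1)` gives `n ≤ 2`.
  have h5 : q + 1 ≤ A.card := by
    have h6 : A.filter (G.Adj v) ⊆ A.erase v := by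
      intro x hx
      rw [Finset.mem_filter] at hx
      exact Finset.mem_erase.2 ⟨hx.2.ne.symm, hx.1⟩
    have h7 := (hdeg v hv).trans (Finset.card_le_card h6)
    rw [Finset.card_erase_of_mem hv] at h7
    have := Finset.card_pos.2 ⟨v, hv⟩
    omega
  rcases Nat.eq_zero_or_pos c with rfl | hc
  · have : 3 * A.card ≤ q * A.card := Nat.mul_le_mul_right _ hq
    omega
  · have := hnum A.card m c (h4.trans h1) (by omega) h3
    omega

/-! ### The seven numerical cases -/

theorem SimpleGraph.CliqueFree.four_le_egirth {V : Type*} {G : SimpleGraph V}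
    (hG : G.CliqueFree 3) : 4 ≤ G.egirth := by
  rw [SimpleGraph.le_egirth]
  intro a w hw
  have h3 : w.length ≠ 3 := by
    intro h
    obtain ⟨s, hs⟩ := SimpleGraph.is3Clique_iff_exists_cycle_length_three.2 ⟨a, w, hw, h⟩
    exact hG s hs
  have := hw.three_le_length
  exact_mod_cast (by omega : 4 ≤ w.length)

theorem corollary3p3 {V : Type u} [Finite V] (G : SimpleGraph V) :
    (IsPlanarGraph G → ∀ q : ℕ, 6 ≤ q → WSKErgodic G q) ∧
    (IsPlanarGraph G → G.CliqueFree 3 → ∀ q : ℕ, 4 ≤ q → WSKErgodic G q) ∧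
    (IsPlanarGraph G → 6 ≤ G.egirth → ∀ q : ℕ, 3 ≤ q → WSKErgodic G q) ∧
    (IsToroidalGraph G → ∀ q : ℕ, 7 ≤ q → WSKErgodic G q) ∧
    (IsToroidalGraph G → G.CliqueFree 3 → ∀ q : ℕ, 5 ≤ q → WSKErgodic G q) ∧
    (IsToroidalGraph G → 5 ≤ G.egirth → ∀ q : ℕ, 4 ≤ q → WSKErgodic G q) ∧
    (IsToroidalGraph G → 7 ≤ G.egirth → ∀ q : ℕ, 3 ≤ q → WSKErgodic G q) := by
  -- At each threshold `q₀` the sum `2/q₀ + 2/g` equals `1` on the sphere, where the `2` in `m + 2 ≤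
  -- n + c` gives the contradiction, and is below `1` on the torus, where `m ≤ n + c` forces `m = 0`
  -- and so `n = 0`.
  have key : ∀ {q₀ q n : ℕ}, q₀ ≤ q → q₀ * n ≤ q * n := fun h => Nat.mul_le_mul_right _ h
  refine ⟨fun hG q hq => ?_, fun hG hc q hq => ?_, fun hG hg q hq => ?_, fun hG q hq => ?_,
    fun hG hc q hq => ?_, fun hG hg q hq => ?_, fun hG hg q hq => ?_⟩
  · refine DrawableOn.wskErgodic circleRankLE_sphere hG (g := 3) SimpleGraph.three_le_egirth
      (by omega) (by omega) fun n m c h1 h2 h3 => ?_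
    have := key (n := n) hq
    omega
  · refine DrawableOn.wskErgodic circleRankLE_sphere hG (g := 4) hc.four_le_egirth
      (by omega) (by omega) fun n m c h1 h2 h3 => ?_
    have := key (n := n) hq
    omega
  · refine DrawableOn.wskErgodic circleRankLE_sphere hG (g := 6) hg
      (by omega) (by omega) fun n m c h1 h2 h3 => ?_
    have := key (n := n) hq
    omega
  · refine DrawableOn.wskErgodic circleRankLE_torus hG (g := 3) SimpleGraph.three_le_egirth
      (by omega) (by omega) fun n m c h1 h2 h3 => ?_
    have := key (n := n) hq
    omega
  · refine DrawableOn.wskErgodic circleRankLE_torus hG (g := 4) hc.four_le_egirth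
      (by omega) (by omega) fun n m c h1 h2 h3 => ?_
    have := key (n := n) hq
    omega
  · refine DrawableOn.wskErgodic circleRankLE_torus hG (g := 5) hg
      (by omega) (by omega) fun n m c h1 h2 h3 => ?_
    have := key (n := n) hq
    omega
  · refine DrawableOn.wskErgodic circleRankLE_torus hG (g := 7) hg
      (by omega) (by omega) fun n m c h1 h2 h3 => ?_
    have := key (n := n) hq
    omega
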